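/- For a number field $K$ with ring of integers $\mathcal{O}_K$, the Pólya group $Po(K)$ is the subgroup of the ideal class group of $K$ generated by the classes of the ideals $\Pi_n(K)$, $n \ge 1$, where $\Pi_n(K)$ is the product of all nonzero prime ideals of $\mathcal{O}_K$ of norm $n$ (and $\Pi_n(K)=\mathcal{O}_K$ if there are none). For integers $m,n$ put $K_{m,n}=\mathbb{Q}(\sqrt m,\sqrt n)\subset\mathbb{C}$; it is called bi-quadratic if it has degree $4$ over $\mathbb{Q}$, and two bi-quadratic fields are called consecutive if they are of the form $K_{m,n}$ and $K_{m,n+1}$. **Theorem.** Let $p$ and $q$ be odd primes with $p=2q+1$, and let $r\ge 1$ be an even integer. Then there are infinitely many pairs $(K_{m,p-1},K_{m,p})$, $m\in\mathbb{Z}$, of consecutive bi-quadratic fields such that $$Po(K_{m,p-1})\cong Po(K_{m,p})\cong(\mathbb{Z}/2\mathbb{Z})^r .$$ Moreover, if $q\equiv 3\pmod 4$, there are infinitely many such pairs with $m=r_1\cdots r_t$, where $t=r+1$ and $r_1,\dots,r_t$ are primes, each $\equiv 1\pmod{8pq}$, such that $r_i$ is a quadratic non-residue modulo $r_j$ for all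 $i\ne j$. -/

import Mathlib

open scoped NumberField nonZeroDivisors

noncomputable section

/-- Only finitely many nonzero prime ideals of a ring of integers have a given norm. -/
theorem finite_primes_of_norm (K : Type*) [Field K] [NumberField K] (n : ℕ) :
    {v : IsDedekindDomain.HeightOneSpectrum (𝓞 K) | Ideal.absNorm v.asIdeal = n}.Finite := by
  rcases Nat.eq_zero_or_pos n with rfl | hn
  · convert Set.finite_empty
    ext v
    simp only [Set.mem_ofPred_eq, Set.mem_empty_iff_false, iff_false]
    exact fun h => v.ne_bot (Ideal.absNorm_eq_zero_iff.mp h)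
  · refine Set.Finite.preimage (f := fun v : IsDedekindDomain.HeightOneSpectrum (𝓞 K) => v.asIdeal)
      ?_ (Ideal.finite_setOfPred_absNorm_eq (S := 𝓞 K) n)
    intro v _ w _ h
    exact IsDedekindDomain.HeightOneSpectrum.ext h

/-- The ideal `Π_n(K)`: the product of all nonzero prime ideals of `𝓞 K` of norm `n`
(the unit ideal if there is none), as an element of the monoid of nonzero ideals. -/
def polyaIdeal (K : Type*) [Field K] [NumberField K] (n : ℕ) : (Ideal (𝓞 K))⁰ :=
  ∏ v ∈ (finite_primes_of_norm K n).toFinset,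
    ⟨v.asIdeal, mem_nonZeroDivisors_of_ne_zero v.ne_bot⟩

/-- The Pólya group `Po(K)`: the subgroup of the ideal class group of `K` generated by the
classes of all the ideals `Π_n(K)`. -/
def polyaGroup (K : Type*) [Field K] [NumberField K] : Subgroup (ClassGroup (𝓞 K)) :=
  Subgroup.closure (Set.range fun n : ℕ => ClassGroup.mk0 (polyaIdeal K n))

/-- The field `K_{m,n} = ℚ(√m, √n)`, as a subfield of `ℂ`. -/
def biquad (m n : ℤ) : IntermediateField ℚ ℂ :=
  IntermediateField.adjoin ℚ {z : ℂ | z ^ 2 = m ∨ z ^ 2 = n}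

instance biquad_numberField (m n : ℤ) : NumberField (biquad m n) := by
  have hfin : ∀ k : ℤ, {z : ℂ | z ^ 2 = k}.Finite := fun k => by
    obtain ⟨w, hw⟩ := IsAlgClosed.exists_pow_nat_eq (k : ℂ) (n := 2) (by norm_num)
    refine (Set.toFinite {w, -w}).subset fun z hz => ?_
    have : z ^ 2 = w ^ 2 := by rw [hw]; exact hz
    simpa using sq_eq_sq_iff_eq_or_eq_neg.mp this
  have hS : {z : ℂ | z ^ 2 = m ∨ z ^ 2 = n}.Finite := (hfin m).union (hfin n)
  have hint : ∀ z ∈ {z : ℂ | z ^ 2 = m ∨ z ^ 2 = n}, IsIntegral ℚ z := by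
    intro z hz
    apply IsIntegral.of_pow (n := 2) (by norm_num)
    rcases hz with h | h <;> rw [h]
    · simpa using isIntegral_algebraMap (R := ℚ) (A := ℂ) (x := (m : ℚ))
    · simpa using isIntegral_algebraMap (R := ℚ) (A := ℂ) (x := (n : ℚ))
  have : FiniteDimensional ℚ (biquad m n) := by
    have := hS.to_subtype
    exact IntermediateField.finiteDimensional_adjoin hint
  exact { to_charZero := inferInstance, to_finiteDimensional := this }

/-- `m` is a product of `t` primes, each congruent to `1` modulo `N`, which are pairwise
quadratic non-residues of one another (in particular they are distinct). -/
def IsNonresidueProduct (N t : ℕ) (m : ℤ) : Prop :=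
  ∃ s : Fin t → ℕ, (∀ i, (s i).Prime ∧ s i ≡ 1 [MOD N]) ∧
    (∀ i j, i ≠ j → ¬ IsSquare ((s i : ℕ) : ZMod (s j))) ∧ m = ∏ i, (s i : ℤ)

/-- The consecutive fields `K_{m,n-1}` and `K_{m,n}` are both bi-quadratic (of degree `4` over
`ℚ`), and their Pólya groups are both isomorphic to `(ℤ/2ℤ)^r`. -/
def ConsecutivePolya (r : ℕ) (m n : ℤ) : Prop :=
  Module.finrank ℚ (biquad m (n - 1)) = 4 ∧ Module.finrank ℚ (biquad m n) = 4 ∧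
    Nonempty (polyaGroup (biquad m (n - 1)) ≃* Multiplicative (Fin r → ZMod 2)) ∧
    Nonempty (polyaGroup (biquad m n) ≃* Multiplicative (Fin r → ZMod 2))

end

/-!
Let `K = ℚ(√m, √n)` with `m ≡ 1 (mod 4)`, `n = p` or `n = p - 1 = 2 q`, and `m`, `n` squarefree.
As `K / ℚ` is Galois, the Pólya group is generated by the classes of the products `J ℓ` of the
primes above the rational primes `ℓ`, where `(J ℓ) ^ e = (ℓ)` for the ramification index `e` of `ℓ`.
Here `e = 2` if `ℓ ∣ 2 m n`, and `e = 1` otherwise. So the Pólya group is generated by classes of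
order at most `2`, one for each `ℓ ∣ 2 m n`, and the product of those at the primes dividing a
squarefree `d` is trivial exactly when `d` is a unit times the square of an algebraic integer `α`
(`BiquadraticGens.exists_polya_classes`).

Relations come from `√m`, from `√n` and, when it exists, from an element of norm `± 2` in `ℤ[√n]`,
that is, from the principality of the ideal above `2`. Such an element exists for `n = p ≡ 3 (mod
4)` and for `n = 2 q` with `q ≡ 3 (mod 4)`, by descent from the fundamental solution of the Pell
equation (`exists_norm_two_of_prime`, `exists_norm_two_of_two_mul_prime`). They leave `r`
generators, at primes dividing `m` (`BiquadraticGens.nonempty_polyaGroup_mulEquiv`), and the point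
is that these are independent.

For `m < 0` the field is CM. If `α ^ 2 ~ d`, then `α` and its complex conjugate differ by a unit of
relative norm `1`, which is `± 1` as `K` contains neither `√-1` nor `√-3`; so `α` or `α √m / d` lies
in `ℚ(√n)`, where only the primes dividing `2 n` ramify (`BiquadraticGens.cm_sq_associated`). This
yields the first assertion. When `ℤ[√(2 q)]` has no element of norm `± 2`, the prime `q` is included
in `m`, so that the relation `√m` removes the class at `q` and `√(2 q)` the class at `2`.

For the second assertion `m` is a product of `r + 1` primes `≡ 1 (mod 8 p q)`, pairwise
non-residues. If `α ^ 2 ~ d`, the relative norm of `α` to `ℚ(√n)` is `d η` with a unit `η`, of norm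
`1`. At a prime `ℓ ∣ m` the primes dividing `2 n`, and `-1`, are squares in `ℤ_ℓ`, hence so is `η`
by Hilbert's Theorem 90 (`isSquare_unit_of_norm_one`), and `d` is a norm from `ℚ_ℓ(√m)`
(`BiquadraticGens.exists_padic_norm`). The tame symbol then says that the number of prime factors of
`d` is even if `ℓ ∤ d`, and that of `m / d` is even if `ℓ ∣ d`. For `d ≠ 1, m` both occur, against
`r + 1` being odd (`BiquadraticGens.not_sq_associated_of_real`).

Finally, the primes can be taken arbitrarily large by Dirichlet's theorem, and a field `ℚ(√m, √p)`
contains `√m'` for no `m'` divisible exactly once by a prime not dividing `m p`, so infinitely many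
pairs of fields arise (`infinite_setOf_biquad`). -/

/-! ### Generators of bi-quadratic fields -/

/-- Square roots `s = √m` and `w = √n` generating a bi-quadratic field `K = ℚ(√m, √n)`: every
element of `K` is a rational combination of `1, s, w, s w`, and none of `m`, `n`, `m n` is a
rational square. -/
structure BiquadraticGens (K : Type*) [Field K] [NumberField K] (m n : ℤ) where
  /-- the square root of `m` -/
  s : K
  /-- the square root of `n` -/
  w : K
  s_sq : s ^ 2 = m
  w_sq : w ^ 2 = n
  coords : ∀ x : K, ∃ a b c d : ℚ, x = a + b * s + c * w + d * (s * w)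
  isGalois : IsGalois ℚ K
  m_nonsq : ¬ IsSquare (m : ℚ)
  n_nonsq : ¬ IsSquare (n : ℚ)
  mn_nonsq : ¬ IsSquare ((m * n : ℤ) : ℚ)

namespace BiquadraticGens

variable {K : Type*} [Field K] [NumberField K] {m n : ℤ} (B : BiquadraticGens K m n)

include B

/-- The elements `1`, `w` are linearly independent over `ℚ`. -/
theorem coords_two_eq_zero {a c : ℚ} (h : (a : K) + c * B.w = 0) : a = 0 ∧ c = 0 := by
  have hw := B.w_sq
  by_cases hc : c = 0
  · subst hc
    simpa using h
  · exfalso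
    apply B.n_nonsq
    refine ⟨-a / c, ?_⟩
    have h2 : (a : K) ^ 2 = c ^ 2 * n := by
      rw [← hw]; linear_combination (a - c * B.w) * h
    have h3 : a ^ 2 = c ^ 2 * n := by exact_mod_cast h2
    field_simp
    linarith

/-- The elements `1, s, w, s w` are linearly independent over `ℚ`, because none of `m`, `n`, `m n`
is a rational square. -/
theorem coords_eq_zero {a b c d : ℚ} (h : (a : K) + b * B.s + c * B.w + d * (B.s * B.w) = 0) :
    a = 0 ∧ b = 0 ∧ c = 0 ∧ d = 0 := by
  have hw := B.w_sq
  have hs := B.s_sq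
  by_cases hbd : b = 0 ∧ d = 0
  · obtain ⟨rfl, rfl⟩ := hbd
    have := B.coords_two_eq_zero (a := a) (c := c) (by simpa using h)
    tauto
  exfalso
  -- otherwise `s` lies in `ℚ(w)`
  set e : ℚ := b ^ 2 - d ^ 2 * n with he
  have he0 : e ≠ 0 := by
    intro h0
    have h1 : ((b : K) + d * B.w) * (b + (-d : ℚ) * B.w) = 0 := by
      have : ((e : ℚ) : K) = 0 := by rw [h0]; simp
      rw [he] at this
      push_cast at this ⊢
      linear_combination this - (d : K) ^ 2 * hw
    rcases mul_eq_zero.mp h1 with h1 | h1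
    · exact hbd (B.coords_two_eq_zero h1)
    · have := B.coords_two_eq_zero h1
      simp at this
      exact hbd this
  obtain ⟨A, C, hAC⟩ : ∃ A C : ℚ, B.s = A + C * B.w := by
    refine ⟨-(a * b - c * d * n) / e, -(c * b - a * d) / e, ?_⟩
    have heK : (e : K) ≠ 0 := by exact_mod_cast he0
    push_cast
    field_simp
    rw [he]
    push_cast
    linear_combination (b - d * B.w) * h + (d ^ 2 * B.s - c * (-d)) * hw
  have h2 : ((A ^ 2 + C ^ 2 * n - m : ℚ) : K) + ((2 * A * C : ℚ) : K) * B.w = 0 := by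
    push_cast
    rw [hAC] at hs
    linear_combination hs - (C : K) ^ 2 * hw
  obtain ⟨h3, h4⟩ := B.coords_two_eq_zero h2
  rcases mul_eq_zero.mp h4 with h4 | h4
  · have hA : A = 0 := by simpa using h4
    apply B.mn_nonsq
    refine ⟨C * n, ?_⟩
    subst hA
    push_cast
    linear_combination -(n : ℚ) * h3
  · apply B.m_nonsq
    refine ⟨A, ?_⟩
    subst h4
    linear_combination -h3

theorem finrank_eq : Module.finrank ℚ K = 4 := by
  let v : Fin 4 → K := ![1, B.s, B.w, B.s * B.w]
  have hli : LinearIndependent ℚ v := by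
    rw [Fintype.linearIndependent_iff]
    intro g hg
    simp only [Fin.sum_univ_four, v, Algebra.smul_def] at hg
    have := B.coords_eq_zero (a := g 0) (b := g 1) (c := g 2) (d := g 3) (by simpa using hg)
    intro i
    fin_cases i <;> simp [this]
  have hsp : ⊤ ≤ Submodule.span ℚ (Set.range v) := by
    intro x _
    obtain ⟨a, b, c, d, rfl⟩ := B.coords x
    rw [Submodule.mem_span_range_iff_exists_fun]
    refine ⟨![a, b, c, d], ?_⟩
    simp [Fin.sum_univ_four, v, Algebra.smul_def]
  simpa using Module.finrank_eq_card_basis (Module.Basis.mk hli hsp)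

theorem aut_s (σ : Gal(K/ℚ)) : σ B.s = B.s ∨ σ B.s = -B.s := by
  apply sq_eq_sq_iff_eq_or_eq_neg.mp
  rw [← map_pow, B.s_sq]; simp

theorem aut_w (σ : Gal(K/ℚ)) : σ B.w = B.w ∨ σ B.w = -B.w := by
  apply sq_eq_sq_iff_eq_or_eq_neg.mp
  rw [← map_pow, B.w_sq]; simp

theorem aut_ext {σ τ : Gal(K/ℚ)} (hs : σ B.s = τ B.s) (hw : σ B.w = τ B.w) : σ = τ := by
  ext x
  obtain ⟨a, b, c, d, rfl⟩ := B.coords x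
  simp [hs, hw]

theorem aut_involutive {δ : Gal(K/ℚ)} (hs : δ B.s = -B.s) (hw : δ B.w = B.w) (x : K) :
    δ (δ x) = x := by
  have : δ * δ = 1 := B.aut_ext (by simp [hs]) (by simp [hw])
  exact congrArg (fun f : Gal(K/ℚ) => f x) this

/-- All four sign changes of `(s, w)` are realised by automorphisms. -/
theorem exists_aut (x y : Bool) : ∃ σ : Gal(K/ℚ),
    σ B.s = (if x then B.s else -B.s) ∧ σ B.w = (if y then B.w else -B.w) := by
  classical
  have := B.isGalois
  have hcard : Nat.card Gal(K/ℚ) = 4 := by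
    rw [IsGalois.card_aut_eq_finrank, B.finrank_eq]
  let f : Gal(K/ℚ) → Bool × Bool := fun σ => (decide (σ B.s = B.s), decide (σ B.w = B.w))
  have hinj : Function.Injective f := by
    intro σ τ h
    simp only [f, Prod.mk.injEq, decide_eq_decide] at h
    apply B.aut_ext
    · by_cases h1 : σ B.s = B.s
      · rw [h1, h.1.mp h1]
      · rw [(B.aut_s σ).resolve_left h1, (B.aut_s τ).resolve_left (fun h2 => h1 (h.1.mpr h2))]
    · by_cases h1 : σ B.w = B.w
      · rw [h1, h.2.mp h1]
      · rw [(B.aut_w σ).resolve_left h1, (B.aut_w τ).resolve_left (fun h2 => h1 (h.2.mpr h2))]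
  have hbij : Function.Bijective f := by
    rw [Nat.bijective_iff_injective_and_card]
    exact ⟨hinj, by rw [hcard]; simp⟩
  obtain ⟨σ, hσ⟩ := hbij.2 (x, y)
  refine ⟨σ, ?_, ?_⟩
  · have h1 : decide (σ B.s = B.s) = x := congrArg Prod.fst hσ
    cases x
    · simpa using (B.aut_s σ).resolve_left (by simpa using h1)
    · simpa using h1
  · have h1 : decide (σ B.w = B.w) = y := congrArg Prod.snd hσ
    cases y
    · simpa using (B.aut_w σ).resolve_left (by simpa using h1)
    · simpa using h1

/-- The nontrivial automorphism fixing `ℚ(w)`. -/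
theorem exists_aut_s : ∃ δ : Gal(K/ℚ), δ B.s = -B.s ∧ δ B.w = B.w := by
  simpa using B.exists_aut false true

/-- The nontrivial automorphism fixing `ℚ(s)`. -/
theorem exists_aut_w : ∃ τ : Gal(K/ℚ), τ B.s = B.s ∧ τ B.w = -B.w := by
  simpa using B.exists_aut true false

/-- The fixed field of `s ↦ -s` is `ℚ(w)`. -/
theorem eq_of_fixed {δ : Gal(K/ℚ)} (hs : δ B.s = -B.s) (hw : δ B.w = B.w) {x : K}
    (hx : δ x = x) : ∃ a c : ℚ, x = a + c * B.w := by
  obtain ⟨a, b, c, d, rfl⟩ := B.coords x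
  refine ⟨a, c, ?_⟩
  simp only [map_add, map_mul, hs, hw, map_ratCast] at hx
  have := B.coords_eq_zero (a := 0) (b := b) (c := 0) (d := d)
    (by simp; linear_combination (-1 / 2) * hx)
  simp [this]

/-- The rational numbers that become squares in `K` are those in the classes of
`1, m, n, m n` modulo rational squares. -/
theorem rat_square {z : K} {d : ℚ} (hz : z ^ 2 = d) :
    IsSquare d ∨ IsSquare (d * m) ∨ IsSquare (d * n) ∨ IsSquare (d * m * n) := by
  obtain ⟨δ, hδs, hδw⟩ := B.exists_aut_s
  obtain ⟨τ, hτs, hτw⟩ := B.exists_aut_w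
  have key : ∀ (y : K) (e : ℚ), y ^ 2 = e → δ y = y → τ y = y → IsSquare e := by
    intro y e hy h1 h2
    obtain ⟨a, c, rfl⟩ := B.eq_of_fixed hδs hδw h1
    simp only [map_add, map_mul, map_ratCast, hτw] at h2
    have := B.coords_two_eq_zero (a := 0) (c := c)
      (by rw [Rat.cast_zero]; linear_combination (-1 / 2) * h2)
    rw [this.2] at hy
    refine ⟨a, ?_⟩
    have : ((a * a : ℚ) : K) = e := by rw [← hy]; push_cast; ring
    exact_mod_cast this.symm
  have sg : ∀ σ : Gal(K/ℚ), σ z = z ∨ σ z = -z := by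
    intro σ
    apply sq_eq_sq_iff_eq_or_eq_neg.mp
    rw [← map_pow, hz]; simp
  rcases sg δ with h1 | h1 <;> rcases sg τ with h2 | h2
  · exact Or.inl (key z d hz h1 h2)
  · refine Or.inr (Or.inr (Or.inl (key (z * B.w) _ ?_ ?_ ?_)))
    · push_cast; rw [mul_pow, hz, B.w_sq]
    · simp [h1, hδw]
    · simp [h2, hτw]
  · refine Or.inr (Or.inl (key (z * B.s) _ ?_ ?_ ?_))
    · push_cast; rw [mul_pow, hz, B.s_sq]
    · simp [h1, hδs]
    · simp [h2, hτs]
  · refine Or.inr (Or.inr (Or.inr (key (z * B.s * B.w) _ ?_ ?_ ?_)))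
    · push_cast; rw [mul_pow, mul_pow, hz, B.s_sq, B.w_sq]
    · simp [h1, hδs, hδw]
    · simp [h2, hτs, hτw]

omit B in
theorem _root_.rat_isInt_of_isIntegral {a : ℚ} (h : IsIntegral ℤ (a : K)) :
    ∃ z : ℤ, a = z := by
  have h' : IsIntegral ℤ a := by
    have := (isIntegral_algHom_iff ((algebraMap ℚ K).toIntAlgHom) (algebraMap ℚ K).injective
      (x := a)).mp (by simpa using h)
    exact this
  obtain ⟨z, hz⟩ := IsIntegrallyClosed.isIntegral_iff.mp h'
  exact ⟨z, by simpa using hz.symm⟩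

omit B in
theorem _root_.rat_isInt_of_squarefree_mul_sq {n : ℤ} (hn : Squarefree n) {c : ℚ} {z : ℤ}
    (h : n * c ^ 2 = z) : ∃ y : ℤ, c = y := by
  have hd : (c.den : ℤ) ^ 2 ∣ n := by
    have h1 : n * c.num ^ 2 = z * (c.den : ℤ) ^ 2 := by
      have h0 : (c.den : ℚ) ≠ 0 := by exact_mod_cast c.den_nz
      have h2 := h
      rw [← Rat.num_div_den c] at h2
      field_simp at h2
      have h3 : n * c.num ^ 2 = (c.den : ℤ) ^ 2 * z := by exact_mod_cast h2
      rw [h3, mul_comm]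
    have hcop : IsCoprime ((c.den : ℤ) ^ 2) (c.num ^ 2) := by
      apply IsCoprime.pow
      rw [Int.isCoprime_iff_gcd_eq_one, Int.gcd_comm]
      simpa [Int.gcd] using c.reduced
    exact hcop.dvd_of_dvd_mul_right ⟨z, by rw [h1]; ring⟩
  have hu := hn (c.den : ℤ) (by rw [← sq]; exact hd)
  have : c.den = 1 := by
    have := Int.isUnit_iff.mp hu
    omega
  exact ⟨c.num, (Rat.den_eq_one_iff c).mp this |>.symm⟩

/-- The ring of integers of `ℚ(√n)` is `ℤ[√n]` when `n ≡ 2, 3 (mod 4)` is squarefree. -/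
theorem eq_int_of_isIntegral (hn : Squarefree n) (hn4 : n % 4 = 2 ∨ n % 4 = 3) {a c : ℚ}
    (h : IsIntegral ℤ ((a : K) + c * B.w)) : ∃ x y : ℤ, a = x ∧ c = y := by
  obtain ⟨τ, hτs, hτw⟩ := B.exists_aut_w
  have h' : IsIntegral ℤ ((a : K) - c * B.w) := by
    have := h.map (τ.toRingEquiv.toRingHom.toIntAlgHom)
    simpa [hτw, sub_eq_add_neg] using this
  obtain ⟨A, hA⟩ := rat_isInt_of_isIntegral (a := 2 * a) (K := K) (by
    have := h.add h'
    rwa [show (a : K) + c * B.w + (a - c * B.w) = ((2 * a : ℚ) : K) by push_cast; ring] at this)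
  obtain ⟨N, hN⟩ := rat_isInt_of_isIntegral (a := a ^ 2 - n * c ^ 2) (K := K) (by
    have := h.mul h'
    rwa [show ((a : K) + c * B.w) * (a - c * B.w) = ((a ^ 2 - n * c ^ 2 : ℚ) : K) by
      push_cast; rw [← B.w_sq]; ring] at this)
  obtain ⟨C, hC⟩ := rat_isInt_of_squarefree_mul_sq hn (c := 2 * c) (z := A ^ 2 - 4 * N) (by
    push_cast; rw [← hA, ← hN]; ring)
  have hrel : A ^ 2 - n * C ^ 2 = 4 * N := by
    have : (A : ℚ) ^ 2 - n * C ^ 2 = 4 * N := by rw [← hA, ← hC, ← hN]; ring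
    exact_mod_cast this
  have h4 : ∀ z : ℤ, z % 2 = 0 ∨ z ^ 2 % 4 = 1 := by
    intro z
    rcases Int.emod_two_eq z with h | h
    · exact Or.inl h
    · right
      obtain ⟨k, rfl⟩ : ∃ k, z = 2 * k + 1 := ⟨z / 2, by omega⟩
      have : (2 * k + 1) ^ 2 = 4 * (k ^ 2 + k) + 1 := by ring
      omega
  have hev : A % 2 = 0 ∧ C % 2 = 0 := by
    have hCC : C % 2 = 0 ∨ (n * C ^ 2) % 4 = n % 4 := by
      rcases h4 C with h | h
      · exact Or.inl h
      · right; rw [Int.mul_emod, h]; simp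
    have hCe : C % 2 = 0 → (n * C ^ 2) % 4 = 0 := by
      intro h
      obtain ⟨k, rfl⟩ : ∃ k, C = 2 * k := ⟨C / 2, by omega⟩
      have : n * (2 * k) ^ 2 = 4 * (n * k ^ 2) := by ring
      omega
    have hAe : A % 2 = 0 → (A ^ 2) % 4 = 0 := by
      intro h
      obtain ⟨k, rfl⟩ : ∃ k, A = 2 * k := ⟨A / 2, by omega⟩
      have : (2 * k) ^ 2 = 4 * (k ^ 2) := by ring
      omega
    rcases h4 A with h | h <;> rcases hCC with h' | h'
    · exact ⟨h, h'⟩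
    · have := hAe h; omega
    · have := hCe h'; omega
    · omega
  refine ⟨A / 2, C / 2, ?_, ?_⟩
  · have : A = 2 * (A / 2) := by omega
    have h2 : (A : ℚ) = 2 * ((A / 2 : ℤ) : ℚ) := by exact_mod_cast this
    linarith
  · have : C = 2 * (C / 2) := by omega
    have h2 : (C : ℚ) = 2 * ((C / 2 : ℤ) : ℚ) := by exact_mod_cast this
    linarith

/-- An algebraic integer of `K` fixed by the automorphism `s ↦ -s` lies in `ℤ[√n]`. -/
theorem exists_int_coords (hn : Squarefree n) (hn4 : n % 4 = 2 ∨ n % 4 = 3)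
    {δ : Gal(K/ℚ)} (hs : δ B.s = -B.s) (hw : δ B.w = B.w) {x : K} (hi : IsIntegral ℤ x)
    (hx : δ x = x) : ∃ a b : ℤ, x = a + b * B.w := by
  obtain ⟨a, c, rfl⟩ := B.eq_of_fixed hs hw hx
  obtain ⟨x, y, rfl, rfl⟩ := B.eq_int_of_isIntegral hn hn4 hi
  exact ⟨x, y, by simp⟩

end BiquadraticGens

theorem nonempty_biquadraticGens {m n : ℤ} (hm : ¬ IsSquare (m : ℚ)) (hn : ¬ IsSquare (n : ℚ))
    (hmn : ¬ IsSquare ((m * n : ℤ) : ℚ)) : Nonempty (BiquadraticGens (biquad m n) m n) := by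
  obtain ⟨s, hs⟩ := IsAlgClosed.exists_pow_nat_eq (m : ℂ) (n := 2) (by norm_num)
  obtain ⟨w, hw⟩ := IsAlgClosed.exists_pow_nat_eq (n : ℂ) (n := 2) (by norm_num)
  have hsm : s ∈ biquad m n := IntermediateField.subset_adjoin _ _ (Or.inl hs)
  have hwm : w ∈ biquad m n := IntermediateField.subset_adjoin _ _ (Or.inr hw)
  have halg : ∀ x ∈ {z : ℂ | z ^ 2 = m ∨ z ^ 2 = n}, IsAlgebraic ℚ x := by
    intro z hz
    have : IsIntegral ℚ z := by
      apply IsIntegral.of_pow (n := 2) (by norm_num)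
      rcases hz with h | h <;> rw [h]
      · simpa using isIntegral_algebraMap (R := ℚ) (A := ℂ) (x := (m : ℚ))
      · simpa using isIntegral_algebraMap (R := ℚ) (A := ℂ) (x := (n : ℚ))
    exact this.isAlgebraic
  have hcoord : ∀ x ∈ biquad m n, ∃ a b c d : ℚ, x = a + b * s + c * w + d * (s * w) := by
    intro x hx
    have hx' : x ∈ Algebra.adjoin ℚ {z : ℂ | z ^ 2 = m ∨ z ^ 2 = n} := by
      rw [← IntermediateField.adjoin_toSubalgebra_of_isAlgebraic halg]
      exact hx
    induction hx' using Algebra.adjoin_induction with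
    | mem z hz =>
      rcases hz with h | h
      · rw [← hs] at h
        rcases sq_eq_sq_iff_eq_or_eq_neg.mp h with rfl | rfl
        · exact ⟨0, 1, 0, 0, by simp⟩
        · exact ⟨0, -1, 0, 0, by simp⟩
      · rw [← hw] at h
        rcases sq_eq_sq_iff_eq_or_eq_neg.mp h with rfl | rfl
        · exact ⟨0, 0, 1, 0, by simp⟩
        · exact ⟨0, 0, -1, 0, by simp⟩
    | algebraMap r => exact ⟨r, 0, 0, 0, by simp⟩
    | add x y _ _ h1 h2 =>
      have hx1 : x ∈ biquad m n := IntermediateField.algebra_adjoin_le_adjoin _ _ ‹_›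
      have hy1 : y ∈ biquad m n := IntermediateField.algebra_adjoin_le_adjoin _ _ ‹_›
      obtain ⟨a, b, c, d, rfl⟩ := h1 hx1
      obtain ⟨a', b', c', d', rfl⟩ := h2 hy1
      exact ⟨a + a', b + b', c + c', d + d', by push_cast; ring⟩
    | mul x y _ _ h1 h2 =>
      have hx1 : x ∈ biquad m n := IntermediateField.algebra_adjoin_le_adjoin _ _ ‹_›
      have hy1 : y ∈ biquad m n := IntermediateField.algebra_adjoin_le_adjoin _ _ ‹_›
      obtain ⟨a, b, c, d, rfl⟩ := h1 hx1
      obtain ⟨a', b', c', d', rfl⟩ := h2 hy1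
      refine ⟨a * a' + b * b' * m + c * c' * n + d * d' * m * n,
        a * b' + b * a' + (c * d' + d * c') * n, a * c' + c * a' + (b * d' + d * b') * m,
        a * d' + d * a' + b * c' + c * b', ?_⟩
      push_cast
      rw [← hs, ← hw]
      ring
  have hgal : IsGalois ℚ (biquad m n) := by
    let P : Polynomial ℚ := (Polynomial.X ^ 2 - Polynomial.C (m : ℚ)) *
      (Polynomial.X ^ 2 - Polynomial.C (n : ℚ))
    have hP0 : P ≠ 0 := mul_ne_zero (Polynomial.X_pow_sub_C_ne_zero (by norm_num) _)
      (Polynomial.X_pow_sub_C_ne_zero (by norm_num) _)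
    have hroot : P.rootSet ℂ = {z : ℂ | z ^ 2 = m ∨ z ^ 2 = n} := by
      ext z
      rw [Polynomial.mem_rootSet]
      simp only [Set.mem_ofPred_eq, ne_eq, hP0, not_false_eq_true, true_and]
      simp [P, sub_eq_zero]
    have := IntermediateField.adjoin_rootSet_isSplittingField
      (K := ℚ) (L := ℂ) (p := P) (IsAlgClosed.splits _)
    rw [hroot] at this
    have hnorm : Normal ℚ (biquad m n) := @Normal.of_isSplittingField _ _ _ _ _ P this
    exact ⟨⟩
  exact ⟨{ s := ⟨s, hsm⟩, w := ⟨w, hwm⟩, s_sq := Subtype.ext (by simpa using hs),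
           w_sq := Subtype.ext (by simpa using hw),
           coords := fun x => by
            obtain ⟨a, b, c, d, h⟩ := hcoord x x.2
            exact ⟨a, b, c, d, Subtype.ext (by simpa using h)⟩
           isGalois := hgal, m_nonsq := hm, n_nonsq := hn, mn_nonsq := hmn }⟩

/-! ### The Pólya group of a Galois number field and ramification -/

section GaloisPolya

open IsDedekindDomain

variable (K : Type*) [Field K] [NumberField K]

/-- The common ramification index in `K` of the primes above `ℓ`; meaningful only for `K / ℚ`
Galois, since `ramificationIdxIn` takes the index of an arbitrary prime above `ℓ`. -/
noncomputable def ramIdx (ℓ : ℕ) : ℕ := (Ideal.span {(ℓ : ℤ)}).ramificationIdxIn (𝓞 K)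

variable {K}

omit [NumberField K] in
theorem liesOver_of_natCast_mem {ℓ : ℕ} (hℓ : ℓ.Prime) (P : Ideal (𝓞 K)) [hP : P.IsPrime]
    (h : (ℓ : 𝓞 K) ∈ P) : P.LiesOver (Ideal.span {(ℓ : ℤ)}) := by
  have hmax : (Ideal.span {(ℓ : ℤ)}).IsMaximal :=
    haveI := Fact.mk hℓ; Int.ideal_span_isMaximal_of_prime ℓ
  refine ⟨hmax.eq_of_le (Ideal.IsPrime.under ℤ P).ne_top ?_⟩
  rw [Ideal.span_singleton_le_iff_mem]
  simpa [Ideal.mem_comap] using h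

omit [NumberField K] in
theorem natCast_mem_of_liesOver {ℓ : ℕ} (P : Ideal (𝓞 K))
    [h : P.LiesOver (Ideal.span {(ℓ : ℤ)})] : (ℓ : 𝓞 K) ∈ P := by
  have : (ℓ : ℤ) ∈ P.under ℤ := by
    rw [← h.over]; exact Ideal.mem_span_singleton_self _
  simpa [Ideal.mem_comap] using this

omit [NumberField K] in
theorem intCast_notMem_of_not_dvd {ℓ : ℕ} (hℓ : ℓ.Prime) (P : Ideal (𝓞 K)) [P.IsPrime]
    (h : (ℓ : 𝓞 K) ∈ P) {c : ℤ} (hc : ¬ (ℓ : ℤ) ∣ c) : (c : 𝓞 K) ∉ P := by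
  intro hcP
  have := liesOver_of_natCast_mem hℓ P h
  have h2 : c ∈ P.under ℤ := by simpa [Ideal.mem_comap] using hcP
  rw [← this.over, Ideal.mem_span_singleton] at h2
  exact hc h2

/-- In a Galois number field, the primes above a rational prime `ℓ` are exactly the primes of some
norm `N`, and `Π_N` to the power of the ramification index of `ℓ` is `(ℓ)`. -/
theorem exists_polyaIdeal_pow [IsGalois ℚ K] {ℓ : ℕ} (hℓ : ℓ.Prime) :
    ∃ N : ℕ, (∀ v : HeightOneSpectrum (𝓞 K),
        Ideal.absNorm v.asIdeal = N ↔ (ℓ : 𝓞 K) ∈ v.asIdeal) ∧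
      (polyaIdeal K N : Ideal (𝓞 K)) ^ ramIdx K ℓ = Ideal.span {(ℓ : 𝓞 K)} := by
  set I : Ideal ℤ := Ideal.span {(ℓ : ℤ)} with hI
  have hmax : I.IsMaximal := haveI := Fact.mk hℓ; Int.ideal_span_isMaximal_of_prime ℓ
  have hI0 : I ≠ 0 := by
    rw [hI]; simpa using hℓ.ne_zero
  obtain ⟨P₀⟩ := (inferInstance : Nonempty (Ideal.primesOver I (𝓞 K)))
  have hP₀ : P₀.1.IsPrime := P₀.2.1
  have hP₀' : P₀.1.LiesOver I := P₀.2.2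
  have hnorm : ∀ v : HeightOneSpectrum (𝓞 K),
      Ideal.absNorm v.asIdeal = Ideal.absNorm P₀.1 ↔ (ℓ : 𝓞 K) ∈ v.asIdeal := by
    intro v
    constructor
    · intro h
      have h1 := Ideal.absNorm_mem v.asIdeal
      rw [h, Ideal.absNorm_eq_pow_inertiaDeg' P₀.1 hℓ] at h1
      push_cast at h1
      exact v.isPrime.mem_of_pow_mem _ h1
    · intro h
      have := liesOver_of_natCast_mem hℓ v.asIdeal h
      have hm : P₀.1.IsMaximal := Ideal.IsMaximal.of_liesOver_isMaximal P₀.1 I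
      rw [Ideal.absNorm_eq_pow_inertiaDeg' P₀.1 hℓ, Ideal.absNorm_eq_pow_inertiaDeg' v.asIdeal hℓ,
        Ideal.inertiaDeg'_eq_inertiaDeg, Ideal.inertiaDeg'_eq_inertiaDeg,
        Ideal.inertiaDeg_eq_of_isGaloisGroup I v.asIdeal P₀.1 Gal(K/ℚ)]
  refine ⟨Ideal.absNorm P₀.1, hnorm, ?_⟩
  have hmap := Ideal.map_algebraMap_eq_finsetProd_pow (R := 𝓞 K) hI0
  have hspan : Ideal.span {(ℓ : 𝓞 K)} = I.map (algebraMap ℤ (𝓞 K)) := by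
    rw [hI, Ideal.map_span, Set.image_singleton]; simp
  rw [hspan, hmap, polyaIdeal, Submonoid.coe_finsetProd, ← Finset.prod_pow]
  refine Finset.prod_bij (fun v _ => v.asIdeal) ?_ ?_ ?_ ?_
  · intro v hv
    rw [Set.Finite.mem_toFinset, Set.mem_ofPred_eq, hnorm] at hv
    rw [Set.mem_toFinset]
    exact ⟨v.isPrime, liesOver_of_natCast_mem hℓ _ hv⟩
  · intro v _ w _ h
    exact HeightOneSpectrum.ext h
  · intro P hP
    rw [Set.mem_toFinset] at hP
    have h1 : P.IsPrime := hP.1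
    have h2 : P.LiesOver I := hP.2
    refine ⟨⟨P, hP.1, Ideal.ne_bot_of_liesOver_of_ne_bot hI0 P⟩, ?_, rfl⟩
    rw [Set.Finite.mem_toFinset, Set.mem_ofPred_eq, hnorm]
    exact natCast_mem_of_liesOver P
  · intro v hv
    rw [Set.Finite.mem_toFinset, Set.mem_ofPred_eq, hnorm] at hv
    have := liesOver_of_natCast_mem hℓ v.asIdeal hv
    rw [ramIdx, Ideal.ramificationIdxIn_eq_ramificationIdx I v.asIdeal Gal(K/ℚ)]

theorem exists_prime_natCast_mem (v : HeightOneSpectrum (𝓞 K)) :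
    ∃ ℓ : ℕ, ℓ.Prime ∧ (ℓ : 𝓞 K) ∈ v.asIdeal := by
  have h0 : Ideal.absNorm v.asIdeal ≠ 0 := Ideal.absNorm_eq_zero_iff.not.mpr v.ne_bot
  have hmem := Ideal.absNorm_mem v.asIdeal
  rw [← Nat.prod_primeFactorsList h0] at hmem
  push_cast at hmem
  obtain ⟨x, hx, hxv⟩ := (Ideal.IsPrime.multiset_prod_mem_iff_exists_mem v.isPrime
    (((Ideal.absNorm v.asIdeal).primeFactorsList.map (fun x : ℕ => (x : 𝓞 K)) :
      List (𝓞 K)) : Multiset (𝓞 K))).mp (by simpa using hmem)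
  simp only [Multiset.mem_coe, List.mem_map] at hx
  obtain ⟨ℓ, hℓ, rfl⟩ := hx
  exact ⟨ℓ, Nat.prime_of_mem_primeFactorsList hℓ, hxv⟩

/-- In a Galois number field the Pólya group is generated by one class for each rational prime
`ℓ`, that of the product `J ℓ` of the primes above `ℓ`. -/
theorem exists_polyaGroup_eq_closure [IsGalois ℚ K] : ∃ J : ℕ → (Ideal (𝓞 K))⁰,
    (∀ ℓ : ℕ, ℓ.Prime → (J ℓ : Ideal (𝓞 K)) ^ ramIdx K ℓ = Ideal.span {(ℓ : 𝓞 K)}) ∧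
    polyaGroup K = Subgroup.closure {c | ∃ ℓ : ℕ, ℓ.Prime ∧ c = ClassGroup.mk0 (J ℓ)} := by
  classical
  choose N hN hpow using fun ℓ : {ℓ : ℕ // ℓ.Prime} => exists_polyaIdeal_pow (K := K) ℓ.2
  refine ⟨fun ℓ => if h : ℓ.Prime then polyaIdeal K (N ⟨ℓ, h⟩) else 1, ?_, ?_⟩
  · intro ℓ hℓ
    simpa [hℓ] using hpow ⟨ℓ, hℓ⟩
  · apply le_antisymm
    · rw [polyaGroup, Subgroup.closure_le]
      rintro _ ⟨n, rfl⟩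
      by_cases hn : ∃ v : HeightOneSpectrum (𝓞 K), Ideal.absNorm v.asIdeal = n
      · obtain ⟨v, hv⟩ := hn
        obtain ⟨ℓ, hℓ, hℓv⟩ := exists_prime_natCast_mem v
        apply Subgroup.subset_closure
        refine ⟨ℓ, hℓ, ?_⟩
        simp only [hℓ, dif_pos]
        rw [← (hN ⟨ℓ, hℓ⟩ v).mpr hℓv, hv]
      · have : polyaIdeal K n = 1 := by
          rw [polyaIdeal]
          apply Finset.prod_eq_one
          intro v hv
          rw [Set.Finite.mem_toFinset] at hv
          exact absurd ⟨v, hv⟩ hn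
        simp only [this, map_one]
        exact one_mem _
    · rw [Subgroup.closure_le]
      rintro _ ⟨ℓ, hℓ, rfl⟩
      apply Subgroup.subset_closure
      refine ⟨N ⟨ℓ, hℓ⟩, ?_⟩
      simp [hℓ]

/-- The residue field of `ℓ` being perfect, the inertia group has order the ramification index. -/
theorem card_inertia_eq_ramIdx [IsGalois ℚ K] {ℓ : ℕ} (hℓ : ℓ.Prime) (P : Ideal (𝓞 K))
    [P.IsPrime] (h : (ℓ : 𝓞 K) ∈ P) : Nat.card (P.inertia Gal(K/ℚ)) = ramIdx K ℓ := by
  have := liesOver_of_natCast_mem hℓ P h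
  have hmax : (Ideal.span {(ℓ : ℤ)}).IsMaximal :=
    haveI := Fact.mk hℓ; Int.ideal_span_isMaximal_of_prime ℓ
  have : Finite (Ideal.span {(ℓ : ℤ)}).ResidueField := by
    have : NeZero ℓ := ⟨hℓ.ne_zero⟩
    have : Finite (ℤ ⧸ Ideal.span {(ℓ : ℤ)}) :=
      Finite.of_equiv (ZMod ℓ) (Int.quotientSpanNatEquivZMod ℓ).symm.toEquiv
    exact Finite.of_surjective _
      (Ideal.bijective_algebraMap_quotient_residueField (Ideal.span {(ℓ : ℤ)})).2
  exact Ideal.card_inertia_eq_ramificationIdxIn (Ideal.span {(ℓ : ℤ)}) P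

theorem exists_isPrime_natCast_mem {ℓ : ℕ} (hℓ : ℓ.Prime) :
    ∃ P : Ideal (𝓞 K), P.IsPrime ∧ (ℓ : 𝓞 K) ∈ P := by
  have hmax : (Ideal.span {(ℓ : ℤ)}).IsMaximal :=
    haveI := Fact.mk hℓ; Int.ideal_span_isMaximal_of_prime ℓ
  obtain ⟨P⟩ := (inferInstance : Nonempty (Ideal.primesOver (Ideal.span {(ℓ : ℤ)}) (𝓞 K)))
  have h1 : P.1.LiesOver (Ideal.span {(ℓ : ℤ)}) := P.2.2
  exact ⟨P.1, P.2.1, natCast_mem_of_liesOver P.1⟩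

/-- A rational prime is unramified if no nontrivial automorphism lies in an inertia group above
it. -/
theorem ramIdx_eq_one [IsGalois ℚ K] {ℓ : ℕ} (hℓ : ℓ.Prime)
    (h : ∀ P : Ideal (𝓞 K), P.IsPrime → (ℓ : 𝓞 K) ∈ P →
      ∀ σ : Gal(K/ℚ), σ ≠ 1 → ∃ x : 𝓞 K, σ • x - x ∉ P) : ramIdx K ℓ = 1 := by
  obtain ⟨P, hP, hℓP⟩ := exists_isPrime_natCast_mem (K := K) hℓ
  rw [← card_inertia_eq_ramIdx hℓ P hℓP, Subgroup.card_eq_one, Subgroup.eq_bot_iff_forall]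
  intro σ hσ
  by_contra hne
  obtain ⟨x, hx⟩ := h P hP hℓP σ hne
  exact hx (hσ x)

/-- In a Galois quartic field the ramification index of `ℓ` is `2` as soon as it is even (as
witnessed by an element `z` with `z ^ 2 / ℓ` prime to `ℓ`) and some automorphism is not in
inertia (as witnessed by `x`). -/
theorem ramIdx_eq_two [IsGalois ℚ K] (h4 : Module.finrank ℚ K = 4) {ℓ : ℕ} (hℓ : ℓ.Prime)
    {z y x : 𝓞 K} {σ : Gal(K/ℚ)} (hz : z ^ 2 = ℓ * y)
    (hy : ∀ P : Ideal (𝓞 K), P.IsPrime → (ℓ : 𝓞 K) ∈ P → y ∉ P)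
    (hx : ∀ P : Ideal (𝓞 K), P.IsPrime → (ℓ : 𝓞 K) ∈ P → σ • x - x ∉ P) : ramIdx K ℓ = 2 := by
  obtain ⟨P, hP, hℓP⟩ := exists_isPrime_natCast_mem (K := K) hℓ
  have hlies := liesOver_of_natCast_mem hℓ P hℓP
  have hmax : (Ideal.span {(ℓ : ℤ)}).IsMaximal :=
    haveI := Fact.mk hℓ; Int.ideal_span_isMaximal_of_prime ℓ
  have hℓ0 : (ℓ : 𝓞 K) ≠ 0 := by exact_mod_cast hℓ.ne_zero
  have hP0 : P ≠ ⊥ := fun h => hℓ0 (by rw [h] at hℓP; simpa using hℓP)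
  have hPp : Prime P := Ideal.prime_of_isPrime hP0 hP
  have hmap : (Ideal.span {(ℓ : ℤ)}).map (algebraMap ℤ (𝓞 K)) = Ideal.span {(ℓ : 𝓞 K)} := by
    rw [Ideal.map_span, Set.image_singleton]; simp
  -- parity of the ramification index
  have heven : 2 ∣ ramIdx K ℓ := by
    have h1 : ramIdx K ℓ = multiplicity P (Ideal.span {(ℓ : 𝓞 K)}) := by
      rw [ramIdx, Ideal.ramificationIdxIn_eq_ramificationIdx _ P Gal(K/ℚ),
        Ideal.IsDedekindDomain.ramificationIdx_eq_multiplicity (Ideal.span {(ℓ : ℤ)}) P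
          (by rw [hmap]; simpa using hℓ0), hmap]
    have hI : (Ideal.span {z}) ^ 2 = Ideal.span {(ℓ : 𝓞 K)} * Ideal.span {y} := by
      rw [Ideal.span_singleton_pow, hz, Ideal.span_singleton_mul_span_singleton]
    have hyP : ¬ P ∣ Ideal.span {y} := by
      rw [Ideal.dvd_span_singleton]; exact hy P hP hℓP
    have hy0 : y ≠ 0 := fun h => hy P hP hℓP (by rw [h]; exact P.zero_mem)
    have hz0 : z ≠ 0 := by
      rintro rfl
      rw [zero_pow two_ne_zero] at hz
      exact (mul_ne_zero hℓ0 hy0) hz.symm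
    have hfin : ∀ a : 𝓞 K, a ≠ 0 → FiniteMultiplicity P (Ideal.span {a}) := fun a ha =>
      FiniteMultiplicity.of_prime_left hPp (by simpa using ha)
    have h2 := congrArg (multiplicity P) hI
    rw [(hfin z hz0).multiplicity_pow hPp, multiplicity_mul hPp
      (by rw [Ideal.span_singleton_mul_span_singleton]; exact hfin _ (mul_ne_zero hℓ0 hy0)),
      multiplicity_eq_zero.mpr hyP, ← h1] at h2
    exact ⟨multiplicity P (Ideal.span {z}), by omega⟩
  have hcard := card_inertia_eq_ramIdx hℓ P hℓP
  have hdvd := Subgroup.card_subgroup_dvd_card (P.inertia Gal(K/ℚ))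
  rw [hcard, IsGalois.card_aut_eq_finrank, h4] at hdvd
  have hne : ramIdx K ℓ ≠ 4 := by
    intro h
    have htop : P.inertia Gal(K/ℚ) = ⊤ := by
      apply Subgroup.eq_top_of_card_eq
      rw [hcard, h, IsGalois.card_aut_eq_finrank, h4]
    have hσ : σ ∈ P.inertia Gal(K/ℚ) := by rw [htop]; trivial
    exact hx P hP hℓP (hσ x)
  have hle := Nat.le_of_dvd (by norm_num) hdvd
  interval_cases h : ramIdx K ℓ <;> omega

end GaloisPolya

/-! ### Elementary abelian `2`-groups -/

section ElementaryTwoGroups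

/-- Independent involutions generate an elementary abelian `2`-group. -/
theorem nonempty_mulEquiv_zmod_two {G : Type*} [CommGroup G] {r : ℕ} (g : Fin r → G)
    (hg : ∀ i, g i ^ 2 = 1) (hind : ∀ S : Finset (Fin r), S.Nonempty → ∏ i ∈ S, g i ≠ 1)
    {H : Subgroup G} (hH : H = Subgroup.closure (Set.range g)) :
    Nonempty (H ≃* Multiplicative (Fin r → ZMod 2)) := by
  let φ : Multiplicative (Fin r → ZMod 2) →* G :=
    { toFun := fun f => ∏ i, g i ^ (f.toAdd i).val
      map_one' := by simp
      map_mul' := by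
        intro a b
        rw [← Finset.prod_mul_distrib]
        refine Finset.prod_congr rfl fun i _ => ?_
        rw [toAdd_mul, Pi.add_apply, ZMod.val_add, ← pow_add]
        conv_rhs => rw [← Nat.div_add_mod ((a.toAdd i).val + (b.toAdd i).val) 2, pow_add, pow_mul,
          hg, one_pow, one_mul] }
  have hφ : ∀ f, φ f = ∏ i, g i ^ (f.toAdd i).val := fun _ => rfl
  have hinj : Function.Injective φ := by
    rw [injective_iff_map_eq_one]
    intro f hf
    by_contra hne
    have hex : ∃ i, f.toAdd i ≠ 0 := by
      by_contra! h
      exact hne (by rw [← toAdd_eq_zero]; exact funext h)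
    obtain ⟨i₀, hi₀⟩ := hex
    refine hind (Finset.univ.filter fun i => f.toAdd i ≠ 0) ⟨i₀, by simp [hi₀]⟩ ?_
    rw [hφ] at hf
    rw [Finset.prod_filter]
    refine (Finset.prod_congr rfl fun i _ => ?_).trans hf
    have h01 : ∀ x : ZMod 2, (if x ≠ 0 then g i else 1) = g i ^ x.val := by
      intro x
      obtain rfl | rfl : x = 0 ∨ x = 1 := by revert x; decide
      · simp
      · simp [ZMod.val_one]
    exact h01 _
  have hrange : φ.range = H := by
    rw [hH]
    apply le_antisymm
    · rintro _ ⟨f, rfl⟩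
      rw [hφ]
      exact Subgroup.prod_mem _ fun i _ =>
        Subgroup.pow_mem _ (Subgroup.subset_closure (Set.mem_range_self i)) _
    · rw [Subgroup.closure_le]
      rintro _ ⟨i, rfl⟩
      refine ⟨Multiplicative.ofAdd (Pi.single i 1), ?_⟩
      rw [hφ, Finset.prod_eq_single i]
      · simp [ZMod.val_one]
      · intro j _ hj
        simp [Pi.single_eq_of_ne hj]
      · simp
  subst hrange
  exact ⟨(φ.ofInjective hinj).symm⟩

theorem Subgroup.mem_of_prod_mem {ι G : Type*} [CommGroup G] (H : Subgroup G) {U : Finset ι}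
    {c : ι → G} (h : ∏ i ∈ U, c i ∈ H) {i : ι} (hi : i ∈ U)
    (hj : ∀ j ∈ U, j ≠ i → c j ∈ H) : c i ∈ H := by
  classical
  rw [← Finset.mul_prod_erase U c hi] at h
  refine (H.mul_mem_cancel_right (H.prod_mem fun j hj' => ?_)).mp h
  exact hj j (Finset.mem_of_mem_erase hj') (Finset.ne_of_mem_erase hj')

end ElementaryTwoGroups

/-! ### Ramification in bi-quadratic fields and classes of ambiguous ideals -/

namespace BiquadraticGens

variable {K : Type*} [Field K] [NumberField K] {m n : ℤ} (B : BiquadraticGens K m n)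

include B

omit B [NumberField K] in
theorem _root_.ringOfIntegers_ext {x y : 𝓞 K} (h : algebraMap (𝓞 K) K x = algebraMap (𝓞 K) K y) :
    x = y :=
  FaithfulSMul.algebraMap_injective (𝓞 K) K h

theorem s_isIntegral : IsIntegral ℤ B.s := by
  apply IsIntegral.of_pow (n := 2) (by norm_num)
  rw [B.s_sq]; simpa using isIntegral_algebraMap (R := ℤ) (A := K) (x := m)

theorem w_isIntegral : IsIntegral ℤ B.w := by
  apply IsIntegral.of_pow (n := 2) (by norm_num)
  rw [B.w_sq]; simpa using isIntegral_algebraMap (R := ℤ) (A := K) (x := n)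

/-- `√m` as an algebraic integer. -/
def sInt : 𝓞 K := ⟨B.s, B.s_isIntegral⟩

/-- `√n` as an algebraic integer. -/
def wInt : 𝓞 K := ⟨B.w, B.w_isIntegral⟩

@[simp] theorem coe_sInt : algebraMap (𝓞 K) K B.sInt = B.s := rfl

@[simp] theorem coe_wInt : algebraMap (𝓞 K) K B.wInt = B.w := rfl

theorem sInt_sq : B.sInt ^ 2 = m := by
  apply ringOfIntegers_ext
  simp [B.s_sq]

theorem wInt_sq : B.wInt ^ 2 = n := by
  apply ringOfIntegers_ext
  simp [B.w_sq]

omit B [NumberField K] in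
theorem _root_.exists_ringOfIntegers_coe {x : K} (h : IsIntegral ℤ x) :
    ∃ y : 𝓞 K, algebraMap (𝓞 K) K y = x :=
  ⟨⟨x, h⟩, rfl⟩

omit B in
theorem _root_.coe_galois_smul (σ : Gal(K/ℚ)) (x : 𝓞 K) :
    algebraMap (𝓞 K) K (σ • x) = σ (algebraMap (𝓞 K) K x) := rfl

omit B in
/-- An automorphism moving a square root of an integer prime to the odd prime `ℓ` acts
nontrivially modulo every prime above `ℓ`. -/
theorem _root_.smul_sub_notMem_of_sq {ℓ : ℕ} (hℓ : ℓ.Prime) (h2 : ℓ ≠ 2) {z : 𝓞 K} {c : ℤ}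
    (hz : z ^ 2 = c) (hc : ¬ (ℓ : ℤ) ∣ c) {σ : Gal(K/ℚ)} (hσ : σ • z = -z) (P : Ideal (𝓞 K))
    (hP : P.IsPrime) (hℓP : (ℓ : 𝓞 K) ∈ P) : σ • z - z ∉ P := by
  intro h
  have h1 : ((4 * c : ℤ) : 𝓞 K) ∈ P := by
    have : ((4 * c : ℤ) : 𝓞 K) = (σ • z - z) * (σ • z - z) := by
      rw [hσ]; push_cast; rw [← hz]; ring
    rw [this]
    exact P.mul_mem_left _ h
  refine intCast_notMem_of_not_dvd hℓ P hℓP ?_ h1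
  intro hd
  have hp := Nat.prime_iff_prime_int.mp hℓ
  rcases hp.dvd_mul.mp hd with h | h
  · have : ℓ ∣ 2 ^ 2 := by exact_mod_cast h
    exact h2 ((Nat.prime_dvd_prime_iff_eq hℓ Nat.prime_two).mp (hℓ.dvd_of_dvd_pow this))
  · exact hc h

/-- An odd prime not dividing `m n` is unramified: an automorphism changing the sign of `√m` or `√n`
already acts nontrivially on it modulo the primes above. -/
theorem ramIdx_of_not_dvd {ℓ : ℕ} (hℓ : ℓ.Prime) (h : ¬ (ℓ : ℤ) ∣ 2 * m * n) :
    ramIdx K ℓ = 1 := by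
  have := B.isGalois
  have h2 : ℓ ≠ 2 := by rintro rfl; exact h ⟨m * n, by push_cast; ring⟩
  have hm : ¬ (ℓ : ℤ) ∣ m := fun h' => h (h'.mul_left 2 |>.mul_right n)
  have hn : ¬ (ℓ : ℤ) ∣ n := fun h' => h (h'.mul_left _)
  apply ramIdx_eq_one hℓ
  intro P hP hℓP σ hσ
  rcases B.aut_s σ with hs | hs
  · rcases B.aut_w σ with hw | hw
    · exact absurd (B.aut_ext (τ := 1) hs hw) hσ
    · exact ⟨B.wInt, smul_sub_notMem_of_sq hℓ h2 B.wInt_sq hn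
        (ringOfIntegers_ext (by simpa [coe_galois_smul] using hw)) P hP hℓP⟩
  · exact ⟨B.sInt, smul_sub_notMem_of_sq hℓ h2 B.sInt_sq hm
      (ringOfIntegers_ext (by simpa [coe_galois_smul] using hs)) P hP hℓP⟩

omit B in
theorem _root_.not_dvd_of_squarefree_mul {ℓ : ℕ} (hℓ : ℓ.Prime) {a : ℤ}
    (h : Squarefree ((ℓ : ℤ) * a)) : ¬ (ℓ : ℤ) ∣ a := by
  intro hd
  have := h (ℓ : ℤ) (mul_dvd_mul_left _ hd)
  exact (Nat.prime_iff_prime_int.mp hℓ).not_isUnit this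

/-- When `m ≡ 1` and `n ≡ 2, 3 (mod 4)` are squarefree, every prime dividing `2 m n` has
ramification index exactly `2`: it ramifies in one of the quadratic subfields and not in all
three. -/
theorem ramIdx_of_dvd (hm : Squarefree m) (hn : Squarefree n) (hm4 : m % 4 = 1)
    (hn4 : n % 4 = 2 ∨ n % 4 = 3) {ℓ : ℕ} (hℓ : ℓ.Prime) (h : (ℓ : ℤ) ∣ 2 * m * n) :
    ramIdx K ℓ = 2 := by
  have := B.isGalois
  have hpr := Nat.prime_iff_prime_int.mp hℓ
  -- some automorphism lies outside inertia
  obtain ⟨σ, x, hx⟩ : ∃ (σ : Gal(K/ℚ)) (x : 𝓞 K), ∀ P : Ideal (𝓞 K), P.IsPrime →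
      (ℓ : 𝓞 K) ∈ P → σ • x - x ∉ P := by
    obtain ⟨δ, hδs, hδw⟩ := B.exists_aut_s
    obtain ⟨τ, hτs, hτw⟩ := B.exists_aut_w
    by_cases h2 : ℓ = 2
    · -- `2` is unramified in `ℚ(√m)`, whose integers include `(1 + √m) / 2`
      subst h2
      obtain ⟨k, hk⟩ : ∃ k, m = 4 * k + 1 := ⟨m / 4, by omega⟩
      have hint : IsIntegral ℤ ((1 + B.s) / 2) := by
        refine ⟨Polynomial.X ^ 2 - Polynomial.X - Polynomial.C k, ?_, ?_⟩
        · have : (Polynomial.X ^ 2 - Polynomial.X - Polynomial.C k : Polynomial ℤ) =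
              Polynomial.X ^ 2 - (Polynomial.X + Polynomial.C k) := by ring
          rw [this]
          exact Polynomial.monic_X_pow_sub (by rw [Polynomial.degree_X_add_C]; norm_num)
        · have hs : B.s ^ 2 = ((4 * k + 1 : ℤ) : K) := by rw [B.s_sq, ← hk]
          push_cast at hs
          simp only [Polynomial.eval₂_sub, Polynomial.eval₂_pow, Polynomial.eval₂_X,
            Polynomial.eval₂_C]
          rw [eq_intCast]
          linear_combination (1 / 4) * hs
      obtain ⟨θ, hθ⟩ := exists_ringOfIntegers_coe hint
      refine ⟨δ, θ, ?_⟩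
      intro P hP hℓP hmem
      have heq : δ • θ - θ = -B.sInt := by
        apply ringOfIntegers_ext
        rw [map_sub, map_neg, coe_galois_smul, hθ, map_div₀, map_add, hδs, map_one, map_ofNat,
          B.coe_sInt]
        ring
      rw [heq] at hmem
      refine intCast_notMem_of_not_dvd hℓ P hℓP (c := m) (by omega) ?_
      rw [← B.sInt_sq, sq]
      exact P.mul_mem_left _ (by simpa using hmem)
    · by_cases hlm : (ℓ : ℤ) ∣ m
      · by_cases hln : (ℓ : ℤ) ∣ n
        · -- here `√(m n) / ℓ` is a square root of an integer prime to `ℓ`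
          obtain ⟨m', rfl⟩ := hlm
          obtain ⟨n', rfl⟩ := hln
          have hm' := not_dvd_of_squarefree_mul hℓ hm
          have hn' := not_dvd_of_squarefree_mul hℓ hn
          have hℓ0 : (ℓ : K) ≠ 0 := by exact_mod_cast hℓ.ne_zero
          have hsq : (B.s * B.w / ℓ) ^ 2 = ((m' * n' : ℤ) : K) := by
            rw [div_pow, mul_pow, B.s_sq, B.w_sq]
            push_cast
            field_simp
          have hint : IsIntegral ℤ (B.s * B.w / ℓ) := by
            apply IsIntegral.of_pow (n := 2) (by norm_num)
            rw [hsq]; simpa using isIntegral_algebraMap (R := ℤ) (A := K) (x := m' * n')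
          obtain ⟨θ, hθ⟩ := exists_ringOfIntegers_coe hint
          refine ⟨δ, θ, smul_sub_notMem_of_sq hℓ h2 (c := m' * n') ?_ ?_ ?_⟩
          · apply ringOfIntegers_ext
            rw [map_pow, hθ, map_intCast, ← hsq]
          · exact fun hd => (hpr.dvd_mul.mp hd).elim hm' hn'
          · apply ringOfIntegers_ext
            rw [map_neg, coe_galois_smul, hθ, map_div₀, map_mul, hδs, hδw, map_natCast]
            ring
        · exact ⟨τ, B.wInt, smul_sub_notMem_of_sq hℓ h2 B.wInt_sq hln
            (ringOfIntegers_ext (by simpa [coe_galois_smul] using hτw))⟩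
      · exact ⟨δ, B.sInt, smul_sub_notMem_of_sq hℓ h2 B.sInt_sq hlm
          (ringOfIntegers_ext (by simpa [coe_galois_smul] using hδs))⟩
  -- the ramification index is even
  obtain ⟨z, y, hz, hy⟩ : ∃ z y : 𝓞 K, z ^ 2 = ℓ * y ∧
      ∀ P : Ideal (𝓞 K), P.IsPrime → (ℓ : 𝓞 K) ∈ P → y ∉ P := by
    by_cases hlm : (ℓ : ℤ) ∣ m
    · obtain ⟨m', rfl⟩ := hlm
      refine ⟨B.sInt, (m' : 𝓞 K), by rw [B.sInt_sq]; push_cast; ring, fun P hP hℓP => ?_⟩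
      exact intCast_notMem_of_not_dvd hℓ P hℓP (not_dvd_of_squarefree_mul hℓ hm)
    by_cases hln : (ℓ : ℤ) ∣ n
    · obtain ⟨n', rfl⟩ := hln
      refine ⟨B.wInt, (n' : 𝓞 K), by rw [B.wInt_sq]; push_cast; ring, fun P hP hℓP => ?_⟩
      exact intCast_notMem_of_not_dvd hℓ P hℓP (not_dvd_of_squarefree_mul hℓ hn)
    have h2 : (ℓ : ℤ) ∣ 2 := by
      rcases hpr.dvd_mul.mp h with h' | h'
      · exact (hpr.dvd_mul.mp h').resolve_right hlm
      · exact absurd h' hln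
    have h2' : ℓ = 2 := (Nat.prime_dvd_prime_iff_eq hℓ Nat.prime_two).mp (by exact_mod_cast h2)
    subst h2'
    -- `(1 + √n) ^ 2 / 2 = √n + (1 + n) / 2` has odd relative norm
    obtain ⟨k, hk⟩ : ∃ k, n = 4 * k + 3 := ⟨n / 4, by push_cast at hln; omega⟩
    have hw : B.wInt ^ 2 = ((4 * k + 3 : ℤ) : 𝓞 K) := by rw [B.wInt_sq, ← hk]
    push_cast at hw
    refine ⟨1 + B.wInt, B.wInt + (2 * k + 2 : ℤ), ?_, fun P hP hℓP hmem => ?_⟩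
    · push_cast
      linear_combination hw
    · refine intCast_notMem_of_not_dvd hℓ P hℓP (c := (4 * k + 3) - (2 * k + 2) ^ 2) ?_ ?_
      · rintro ⟨t, ht⟩
        have : (4 * k + 3) - (2 * k + 2) ^ 2 = 2 * (-2 * k ^ 2 - 2 * k) - 1 := by ring
        push_cast at ht
        omega
      · have : (((4 * k + 3) - (2 * k + 2) ^ 2 : ℤ) : 𝓞 K) =
            (B.wInt - (2 * k + 2 : ℤ)) * (B.wInt + (2 * k + 2 : ℤ)) := by
          push_cast
          linear_combination -hw
        rw [this]
        exact P.mul_mem_left _ hmem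
  exact ramIdx_eq_two B.finrank_eq hℓ hz hy hx

omit B in
theorem _root_.ideal_eq_of_sq_eq {I J : Ideal (𝓞 K)} (h : I ^ 2 = J ^ 2) : I = J :=
  dvd_antisymm ((UniqueFactorizationMonoid.pow_dvd_pow_iff_dvd two_ne_zero).mp h.dvd)
    ((UniqueFactorizationMonoid.pow_dvd_pow_iff_dvd two_ne_zero).mp h.symm.dvd)

/-- The Pólya group of `ℚ(√m, √n)` is generated by classes `c ℓ` of order dividing `2`, one for
each ramified prime `ℓ`; and a product of distinct `c ℓ` is trivial exactly when the product `d` of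
the corresponding primes is, up to a unit, the square of an algebraic integer of `K`. -/
theorem exists_polya_classes (hm : Squarefree m) (hn : Squarefree n) (hm4 : m % 4 = 1)
    (hn4 : n % 4 = 2 ∨ n % 4 = 3) : ∃ c : ℕ → ClassGroup (𝓞 K),
    polyaGroup K = Subgroup.closure {x | ∃ ℓ : ℕ, ℓ.Prime ∧ (ℓ : ℤ) ∣ 2 * m * n ∧ x = c ℓ} ∧
    ∀ U : Finset ℕ, (∀ ℓ ∈ U, ℓ.Prime ∧ (ℓ : ℤ) ∣ 2 * m * n) →
      (∏ ℓ ∈ U, c ℓ) ^ 2 = 1 ∧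
      (∏ ℓ ∈ U, c ℓ = 1 ↔ ∃ z : 𝓞 K, Associated (z ^ 2) ((∏ ℓ ∈ U, ℓ : ℕ) : 𝓞 K)) := by
  have := B.isGalois
  obtain ⟨J, hJ, hpol⟩ := exists_polyaGroup_eq_closure (K := K)
  refine ⟨fun ℓ => ClassGroup.mk0 (J ℓ), ?_, ?_⟩
  · rw [hpol]
    apply le_antisymm
    · rw [Subgroup.closure_le]
      rintro _ ⟨ℓ, hℓ, rfl⟩
      by_cases h : (ℓ : ℤ) ∣ 2 * m * n
      · exact Subgroup.subset_closure ⟨ℓ, hℓ, h, rfl⟩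
      · have h1 := hJ ℓ hℓ
        rw [B.ramIdx_of_not_dvd hℓ h, pow_one] at h1
        have : ClassGroup.mk0 (J ℓ) = 1 := by
          rw [ClassGroup.mk0_eq_one_iff (J ℓ).2, h1]
          exact ⟨⟨_, rfl⟩⟩
        rw [SetLike.mem_coe, this]
        exact one_mem _
    · apply Subgroup.closure_mono
      rintro _ ⟨ℓ, hℓ, _, rfl⟩
      exact ⟨ℓ, hℓ, rfl⟩
  · intro U hU
    have hsq : ((∏ ℓ ∈ U, J ℓ : (Ideal (𝓞 K))⁰) : Ideal (𝓞 K)) ^ 2 =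
        Ideal.span {((∏ ℓ ∈ U, ℓ : ℕ) : 𝓞 K)} := by
      rw [Submonoid.coe_finsetProd, ← Finset.prod_pow]
      push_cast
      rw [← Ideal.prod_span_singleton]
      refine Finset.prod_congr rfl fun ℓ hℓ => ?_
      rw [← hJ ℓ (hU ℓ hℓ).1, B.ramIdx_of_dvd hm hn hm4 hn4 (hU ℓ hℓ).1 (hU ℓ hℓ).2]
    rw [← map_prod]
    constructor
    · rw [← map_pow, ClassGroup.mk0_eq_one_iff (SetLike.coe_mem _), SubmonoidClass.coe_pow, hsq]
      exact ⟨⟨_, rfl⟩⟩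
    · rw [ClassGroup.mk0_eq_one_iff (SetLike.coe_mem _)]
      constructor
      · rintro ⟨⟨z, hz⟩⟩
        refine ⟨z, ?_⟩
        rw [← Ideal.span_singleton_eq_span_singleton, ← hsq, hz, ← Ideal.span_singleton_pow]
      · rintro ⟨z, hz⟩
        rw [← Ideal.span_singleton_eq_span_singleton, ← Ideal.span_singleton_pow, ← hsq] at hz
        exact ⟨⟨z, (ideal_eq_of_sq_eq hz).symm⟩⟩

end BiquadraticGens

/-! ### Elements of norm `± 2` in real quadratic fields -/

section PellDescent

/-- Coprime positive integers with product `p w ^ 2` are a square and `p` times a square. -/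
theorem eq_sq_or_eq_prime_mul_sq {p u v w : ℤ} (hp : Prime p) (hp0 : 0 < p) (hu : 0 < u)
    (hv : 0 < v) (huv : IsCoprime u v) (h : u * v = p * w ^ 2) :
    (∃ a b, u = a ^ 2 ∧ v = p * b ^ 2) ∨ (∃ a b, u = p * a ^ 2 ∧ v = b ^ 2) := by
  have sq_of : ∀ {x y : ℤ}, 0 < x → IsCoprime x y → x * y = w ^ 2 → ∃ a, x = a ^ 2 := by
    intro x y hx hxy hw
    obtain ⟨a, ha | ha⟩ := Int.sq_of_isCoprime hxy hw
    · exact ⟨a, ha⟩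
    · nlinarith [sq_nonneg a]
  have hdvd : p ∣ u * v := ⟨_, h⟩
  rcases hp.dvd_mul.mp hdvd with ⟨u', rfl⟩ | ⟨v', rfl⟩
  · right
    have hu' : 0 < u' := pos_of_mul_pos_right hu hp0.le
    have hcop : IsCoprime u' v := huv.of_mul_left_right
    have h' : u' * v = w ^ 2 := mul_left_cancel₀ hp0.ne' (by linear_combination h)
    obtain ⟨a, ha⟩ := sq_of hu' hcop h'
    obtain ⟨b, hb⟩ := sq_of hv hcop.symm (by rw [mul_comm]; exact h')
    exact ⟨a, b, by rw [ha], hb⟩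
  · left
    have hv' : 0 < v' := pos_of_mul_pos_right hv hp0.le
    have hcop : IsCoprime u v' := huv.of_mul_right_right
    have h' : u * v' = w ^ 2 := mul_left_cancel₀ hp0.ne' (by linear_combination h)
    obtain ⟨a, ha⟩ := sq_of hu hcop h'
    obtain ⟨b, hb⟩ := sq_of hv' hcop.symm (by rw [mul_comm]; exact h')
    exact ⟨a, b, ha, by rw [hb]⟩

/-- A solution of the Pell equation cannot be smaller than the fundamental one. -/
theorem Pell.IsFundamental.not_smaller {d : ℤ} {f : Pell.Solution₁ d} (hf : Pell.IsFundamental f)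
    {a b : ℤ} (h : b ^ 2 - d * a ^ 2 = 1) (ha : a ≠ 0) : f.y ≤ |a| := by
  have hd := hf.d_pos
  have hsol : |b| ^ 2 - d * |a| ^ 2 = 1 := by rw [sq_abs, sq_abs]; exact h
  have ha' : 0 < |a| := abs_pos.mpr ha
  have h1 : 1 < |b| := by
    have : 0 < d * |a| ^ 2 := by positivity
    nlinarith [abs_nonneg b]
  have := hf.y_le_y (a := Pell.Solution₁.mk |b| |a| hsol) (by simpa using h1) (by simpa using ha')
  simpa using this

theorem Int.isCoprime_of_sub_eq_one {u v : ℤ} (h : v - u = 1) : IsCoprime u v :=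
  ⟨-1, 1, by linarith⟩

/-- Half of the factorization `(x - 1) (x + 1) = d y ^ 2` at an odd fundamental solution. -/
theorem Pell.IsFundamental.exists_half {d : ℤ} {f : Pell.Solution₁ d} (hf : Pell.IsFundamental f)
    (hodd : f.x % 2 = 1) (hd : d % 4 ≠ 0) :
    ∃ u v z : ℤ, 0 < u ∧ 0 < v ∧ v - u = 1 ∧ u * v = d * z ^ 2 ∧ f.y = 2 * z ∧ 0 < z := by
  have hprop := f.prop
  obtain ⟨k, hk⟩ : ∃ k, f.x = 2 * k + 1 := ⟨f.x / 2, by omega⟩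
  have hx := hf.1
  have hy := hf.2.1
  have hk0 : 0 < k := by omega
  have heven : f.y % 2 = 0 := by
    by_contra hne
    obtain ⟨j, hj⟩ : ∃ j, f.y = 2 * j + 1 := ⟨f.y / 2, by omega⟩
    rw [hk, hj] at hprop
    apply hd
    have : d = 4 * (k ^ 2 + k - d * (j ^ 2 + j)) := by linear_combination -hprop
    omega
  obtain ⟨z, hz⟩ : ∃ z, f.y = 2 * z := ⟨f.y / 2, by omega⟩
  refine ⟨k, k + 1, z, hk0, by omega, by ring, ?_, hz, by omega⟩
  rw [hk, hz] at hprop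
  linarith

theorem Int.sq_emod_four (z : ℤ) : z ^ 2 % 4 = 0 ∨ z ^ 2 % 4 = 1 := by
  rcases Int.even_or_odd' z with ⟨k, rfl | rfl⟩
  · left; have : (2 * k) ^ 2 = 4 * k ^ 2 := by ring
    omega
  · right; have : (2 * k + 1) ^ 2 = 4 * (k ^ 2 + k) + 1 := by ring
    omega

theorem Int.sq_emod_eight (z : ℤ) : z ^ 2 % 8 = 0 ∨ z ^ 2 % 8 = 1 ∨ z ^ 2 % 8 = 4 := by
  have h : z % 8 = 0 ∨ z % 8 = 1 ∨ z % 8 = 2 ∨ z % 8 = 3 ∨ z % 8 = 4 ∨ z % 8 = 5 ∨ z % 8 = 6 ∨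
    z % 8 = 7 := by omega
  rcases h with h | h | h | h | h | h | h | h <;> simp [sq, Int.mul_emod, h]

theorem abs_lt_of_mul_eq {a b z : ℤ} (hz : 0 < z) (h : (a * b) ^ 2 = z ^ 2) : |a| < 2 * z := by
  have h1 : |a| * |b| = z := by
    rw [← abs_mul, ← abs_of_pos hz]; exact sq_eq_sq_iff_abs_eq_abs _ _ |>.mp h
  have hb : 0 < |b| := by
    rcases (abs_nonneg b).lt_or_eq with hb | hb
    · exact hb
    · rw [← hb] at h1; simp at h1; omega
  nlinarith [abs_nonneg a]

/-- For a prime `p ≡ 3 (mod 4)` the prime of `ℚ(√p)` above `2` is principal: factoring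
`(x - 1) (x + 1) = p y ^ 2` at the fundamental solution of the Pell equation gives an element of
norm `± 2`, or else an element of norm `-1` (impossible modulo `4`) or a smaller solution. -/
theorem exists_norm_two_of_prime {p : ℕ} (hp : p.Prime) (hp4 : p % 4 = 3) :
    ∃ x y : ℤ, x ^ 2 - p * y ^ 2 = 2 ∨ x ^ 2 - p * y ^ 2 = -2 := by
  have hpr := Nat.prime_iff_prime_int.mp hp
  have hp0 : (0 : ℤ) < p := by exact_mod_cast hp.pos
  obtain ⟨f, hf⟩ := Pell.IsFundamental.exists_of_not_isSquare hp0 (by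
    rintro ⟨k, hk⟩
    exact hpr.irreducible.not_isSquare ⟨k, hk⟩)
  have hprop := f.prop
  rcases Int.emod_two_eq f.x with he | ho
  · obtain ⟨k, hk⟩ : ∃ k, f.x = 2 * k := ⟨f.x / 2, by omega⟩
    have hx := hf.1
    have hcop : IsCoprime (f.x - 1) (f.x + 1) := ⟨k, 1 - k, by rw [hk]; ring⟩
    rcases eq_sq_or_eq_prime_mul_sq hpr hp0 (by omega) (by omega) hcop
      (w := f.y) (by linear_combination hprop) with ⟨a, b, h1, h2⟩ | ⟨a, b, h1, h2⟩
    · exact ⟨a, b, Or.inr (by linarith)⟩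
    · exact ⟨b, a, Or.inl (by linarith)⟩
  · obtain ⟨u, v, z, hu, hv, huv, hmul, hyz, hz⟩ := hf.exists_half ho (by omega)
    rcases eq_sq_or_eq_prime_mul_sq hpr hp0 hu hv (Int.isCoprime_of_sub_eq_one huv) hmul with
      ⟨a, b, rfl, rfl⟩ | ⟨a, b, rfl, rfl⟩
    · exfalso
      obtain ⟨t, ht⟩ : ∃ t : ℤ, (p : ℤ) = 4 * t + 3 := ⟨p / 4, by omega⟩
      rw [ht] at huv
      have h4 : 4 * (t * b ^ 2) + 3 * b ^ 2 - a ^ 2 = 1 := by linear_combination huv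
      rcases Int.sq_emod_four a with ha | ha <;> rcases Int.sq_emod_four b with hb | hb <;> omega
    · exfalso
      have ha : a ≠ 0 := by rintro rfl; simp at hu
      have h1 := hf.not_smaller huv ha
      have h2 : (a * b) ^ 2 = z ^ 2 := mul_left_cancel₀ hp0.ne' (by linear_combination hmul)
      have := abs_lt_of_mul_eq hz h2
      omega

/-- For a prime `q ≡ 3 (mod 4)` the prime of `ℚ(√(2q))` above `2` is principal, by the same descent
from the fundamental solution; a norm `-1` is now impossible modulo `8`. -/
theorem exists_norm_two_of_two_mul_prime {q : ℕ} (hq : q.Prime) (hq4 : q % 4 = 3) :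
    ∃ x y : ℤ, x ^ 2 - (2 * q) * y ^ 2 = 2 ∨ x ^ 2 - (2 * q) * y ^ 2 = -2 := by
  have hqr := Nat.prime_iff_prime_int.mp hq
  have hq0 : (0 : ℤ) < q := by exact_mod_cast hq.pos
  obtain ⟨f, hf⟩ := Pell.IsFundamental.exists_of_not_isSquare (d := 2 * (q : ℤ)) (by omega) (by
    rintro ⟨k, hk⟩
    rcases Int.sq_emod_four k with h | h <;> rw [sq, ← hk] at h <;> omega)
  have hprop := f.prop
  have ho : f.x % 2 = 1 := by
    by_contra hne
    obtain ⟨k, hk⟩ : ∃ k, f.x = 2 * k := ⟨f.x / 2, by omega⟩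
    rw [hk] at hprop
    have : 2 * (2 * k ^ 2 - q * f.y ^ 2) = 1 := by linear_combination hprop
    omega
  obtain ⟨u, v, z, hu, hv, huv, hmul, hyz, hz⟩ := hf.exists_half ho (by omega)
  rcases Int.even_or_odd' u with ⟨u', rfl | hu'⟩
  · have hcop : IsCoprime u' v := (Int.isCoprime_of_sub_eq_one huv).of_mul_left_right
    rcases eq_sq_or_eq_prime_mul_sq hqr hq0 (by omega) hv hcop (w := z) (by linarith) with
      ⟨a, b, rfl, rfl⟩ | ⟨a, b, rfl, rfl⟩
    · exact ⟨2 * a, b, Or.inr (by linear_combination -2 * huv)⟩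
    · exfalso
      have ha : a ≠ 0 := by rintro rfl; simp at hu
      have h1 := hf.not_smaller (a := a) (b := b) (by linear_combination huv) ha
      have h2 : (a * b) ^ 2 = z ^ 2 :=
        mul_left_cancel₀ (mul_pos two_pos hq0).ne' (by linear_combination hmul)
      have := abs_lt_of_mul_eq hz h2
      omega
  · obtain ⟨v', rfl⟩ : ∃ v', v = 2 * v' := ⟨u' + 1, by omega⟩
    have hcop : IsCoprime u v' := (Int.isCoprime_of_sub_eq_one huv).of_mul_right_right
    rcases eq_sq_or_eq_prime_mul_sq hqr hq0 hu (by omega) hcop (w := z) (by linarith) with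
      ⟨a, b, h1, rfl⟩ | ⟨a, b, h1, rfl⟩
    · exfalso
      obtain ⟨t, ht⟩ : ∃ t : ℤ, (q : ℤ) = 4 * t + 3 := ⟨q / 4, by omega⟩
      rw [ht, h1] at huv
      have h8 : 8 * (t * b ^ 2) + 6 * b ^ 2 - a ^ 2 = 1 := by linear_combination huv
      rcases Int.sq_emod_eight a with ha | ha | ha <;>
        rcases Int.sq_emod_eight b with hb | hb | hb <;> omega
    · exact ⟨2 * b, a, Or.inl (by rw [h1] at huv; linear_combination 2 * huv)⟩

end PellDescent

/-! ### Associated elements in rings of integers -/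

section IntegersInRings

variable {K : Type*} [Field K] [NumberField K]

/-- Divisibility between rational integers does not change in `𝓞 K`, as `ℤ` is integrally closed. -/
theorem intCast_dvd_intCast_iff {a b : ℤ} : (a : 𝓞 K) ∣ b ↔ a ∣ b := by
  constructor
  · rintro ⟨y, hy⟩
    by_cases ha : a = 0
    · subst ha
      have : (b : 𝓞 K) = 0 := by simpa using hy
      rw [Int.cast_eq_zero.mp this]
    · have haK : (a : K) ≠ 0 := by exact_mod_cast ha
      have h1 : algebraMap (𝓞 K) K y = ((b / a : ℚ) : K) := by
        have h2 := congrArg (algebraMap (𝓞 K) K) hy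
        simp only [map_mul, map_intCast] at h2
        push_cast
        field_simp
        linear_combination -h2
      obtain ⟨z, hz⟩ := rat_isInt_of_isIntegral (K := K) (a := (b / a : ℚ))
        (by rw [← h1]; exact y.2)
      refine ⟨z, ?_⟩
      have ha' : (a : ℚ) ≠ 0 := by exact_mod_cast ha
      field_simp at hz
      exact_mod_cast hz
  · rintro ⟨c, rfl⟩
    exact ⟨c, by push_cast; ring⟩

theorem eq_or_eq_neg_of_associated {a : ℤ} {c : ℕ} (h : Associated (a : 𝓞 K) c) :
    a = c ∨ a = -c := by
  have h1 : a ∣ c := intCast_dvd_intCast_iff.mp (by simpa using h.dvd)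
  have h2 : (c : ℤ) ∣ a := intCast_dvd_intCast_iff.mp (by simpa using h.symm.dvd)
  have := Int.natAbs_dvd_natAbs.mpr h1 |>.antisymm (Int.natAbs_dvd_natAbs.mpr h2)
  omega

theorem associated_of_sq {x y : 𝓞 K} (h : Associated (x ^ 2) (y ^ 2)) : Associated x y := by
  rw [← Ideal.span_singleton_eq_span_singleton]
  apply ideal_eq_of_sq_eq
  rwa [Ideal.span_singleton_pow, Ideal.span_singleton_pow, Ideal.span_singleton_eq_span_singleton]

theorem associated_galois_smul {x y : 𝓞 K} (h : Associated x y) (σ : Gal(K/ℚ)) :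
    Associated (σ • x) (σ • y) :=
  h.map (MulSemiringAction.toRingHom Gal(K/ℚ) (𝓞 K) σ)

theorem galois_smul_natCast (σ : Gal(K/ℚ)) (c : ℕ) : σ • (c : 𝓞 K) = c :=
  map_natCast (MulSemiringAction.toRingHom Gal(K/ℚ) (𝓞 K) σ) c

theorem galois_smul_sq_associated {x : 𝓞 K} {c : ℕ} (h : Associated (x ^ 2) c) (σ : Gal(K/ℚ)) :
    Associated ((σ • x) ^ 2) c := by
  have := associated_galois_smul h σ
  rwa [smul_pow', galois_smul_natCast] at this

end IntegersInRings

/-! ### Ambiguous principal ideals of CM bi-quadratic fields -/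

theorem Complex.conj_eq_self_of_sq {z : ℂ} {r : ℝ} (hr : 0 ≤ r) (h : z ^ 2 = r) :
    (starRingEnd ℂ) z = z := by
  have h1 : ((Real.sqrt r : ℝ) : ℂ) ^ 2 = r := by rw [← Complex.ofReal_pow, Real.sq_sqrt hr]
  rcases sq_eq_sq_iff_eq_or_eq_neg.mp (h.trans h1.symm) with rfl | rfl <;> simp

theorem Complex.conj_eq_neg_of_sq {z : ℂ} {r : ℝ} (hr : r ≤ 0) (h : z ^ 2 = r) :
    (starRingEnd ℂ) z = -z := by
  have h1 : (((Real.sqrt (-r) : ℝ) : ℂ) * Complex.I) ^ 2 = r := by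
    rw [mul_pow, ← Complex.ofReal_pow, Real.sq_sqrt (by linarith), Complex.I_sq]; simp
  rcases sq_eq_sq_iff_eq_or_eq_neg.mp (h.trans h1.symm) with rfl | rfl <;> simp

namespace BiquadraticGens

variable {K : Type*} [Field K] [NumberField K] {m n : ℤ} (B : BiquadraticGens K m n)

include B

/-- For `m < 0 < n` the field is a CM field, and `s ↦ -s` is complex conjugation. -/
theorem conj_embedding (hm0 : m < 0) (hn0 : 0 < n) {δ : Gal(K/ℚ)} (hs : δ B.s = -B.s)
    (hw : δ B.w = B.w) (φ : K →+* ℂ) (x : K) : (starRingEnd ℂ) (φ x) = φ (δ x) := by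
  have h1 : (starRingEnd ℂ) (φ B.s) = -φ B.s := by
    apply Complex.conj_eq_neg_of_sq (r := m) (by exact_mod_cast hm0.le)
    rw [← map_pow, B.s_sq]; simp
  have h2 : (starRingEnd ℂ) (φ B.w) = φ B.w := by
    apply Complex.conj_eq_self_of_sq (r := n) (by exact_mod_cast hn0.le)
    rw [← map_pow, B.w_sq]; simp
  obtain ⟨a, b, c, d, rfl⟩ := B.coords x
  simp [h1, h2, hs, hw]

/-- In a CM bi-quadratic field not containing `√-1` or `√-3`, the only algebraic integers of
relative norm `1` over the real quadratic subfield are `1` and `-1`. Their relative trace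
`a + b √n` has all conjugates in `[-2, 2]`, which forces `b = 0` and leaves five quadratic
equations. -/
theorem eq_one_or_neg_one_of_norm_one (hm0 : m < 0) (hn5 : 5 ≤ n) (hn : Squarefree n)
    (hn4 : n % 4 = 2 ∨ n % 4 = 3) (h1 : ∀ z : K, z ^ 2 ≠ (-1 : ℤ)) (h3 : ∀ z : K, z ^ 2 ≠ (-3 : ℤ))
    {δ : Gal(K/ℚ)} (hs : δ B.s = -B.s) (hw : δ B.w = B.w) {u : K} (hui : IsIntegral ℤ u)
    (hu : u * δ u = 1) : u = 1 ∨ u = -1 := by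
  obtain ⟨τ, hτs, hτw⟩ := B.exists_aut_w
  have hδδ := B.aut_involutive hs hw
  have hδui : IsIntegral ℤ (δ u) := hui.map (δ.toRingEquiv.toRingHom.toIntAlgHom)
  obtain ⟨a, b, hab⟩ := B.exists_int_coords hn hn4 hs hw (hui.add hδui)
    (by rw [map_add, hδδ, add_comm])
  obtain ⟨φ⟩ : Nonempty (K →+* ℂ) := inferInstance
  have hbound : ∀ ψ : K →+* ℂ, (ψ (u + δ u)).re ≤ 2 ∧ -2 ≤ (ψ (u + δ u)).re := by
    intro ψ
    have hns : Complex.normSq (ψ u) = 1 := by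
      have : ψ u * (starRingEnd ℂ) (ψ u) = 1 := by
        rw [B.conj_embedding hm0 (by omega) hs hw, ← map_mul, hu, map_one]
      rw [Complex.mul_conj] at this
      exact_mod_cast this
    have hre : (ψ (u + δ u)).re = 2 * (ψ u).re := by
      rw [map_add, ← B.conj_embedding hm0 (by omega) hs hw, Complex.add_re, Complex.conj_re]; ring
    rw [Complex.normSq_apply] at hns
    rw [hre]
    constructor <;> nlinarith [mul_self_nonneg (ψ u).im]
  set ω : ℝ := (φ B.w).re with hω
  have hωw : φ B.w = (ω : ℂ) := by
    have h2 : (starRingEnd ℂ) (φ B.w) = φ B.w := by rw [B.conj_embedding hm0 (by omega) hs hw, hw]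
    exact (Complex.conj_eq_iff_re.mp h2).symm
  have hωsq : ω ^ 2 = n := by
    have : φ (B.w ^ 2) = φ (n : K) := by rw [B.w_sq]
    rw [map_pow, hωw, map_intCast] at this
    exact_mod_cast this
  have e1 := hbound φ
  have e2 := hbound (φ.comp τ.toRingEquiv.toRingHom)
  have v1 : (φ (u + δ u)).re = a + b * ω := by
    rw [hab, map_add, map_mul, hωw]; simp
  have v2 : ((φ.comp τ.toRingEquiv.toRingHom) (u + δ u)).re = a - b * ω := by
    rw [hab]
    simp [hτw, hωw, sub_eq_add_neg]
  rw [v1] at e1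
  rw [v2] at e2
  -- the two conjugates `a ± b √n` are at most `2` in absolute value, so `b ^ 2 n ≤ 4 < n`
  have hb2 : ((b : ℝ) * ω) ^ 2 ≤ 4 := by nlinarith
  have hb0 : b = 0 := by
    rw [mul_pow, hωsq] at hb2
    have hb2' : b ^ 2 * n ≤ 4 := by exact_mod_cast hb2
    by_contra hne
    have : 0 < b ^ 2 := by positivity
    nlinarith
  subst hb0
  have ha : -2 ≤ a ∧ a ≤ 2 := by
    have hr : (-2 : ℝ) ≤ a ∧ (a : ℝ) ≤ 2 := by
      simp only [Int.cast_zero, zero_mul, add_zero] at e1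
      exact ⟨e1.2, e1.1⟩
    exact_mod_cast hr
  have hquad : u ^ 2 - a * u + 1 = 0 := by
    have : u + δ u = a := by simpa using hab
    linear_combination u * this - hu
  obtain ⟨ha1, ha2⟩ := ha
  -- `a = ± 1` would give a square root of `-3`, and `a = 0` one of `-1`
  interval_cases a
  · right
    push_cast at hquad
    have : (u + 1) ^ 2 = 0 := by linear_combination hquad
    exact eq_neg_of_add_eq_zero_left (pow_eq_zero_iff two_ne_zero |>.mp this)
  · exact absurd (by push_cast at hquad ⊢; linear_combination 4 * hquad) (h3 (2 * u + 1))
  · exact absurd (by push_cast at hquad ⊢; linear_combination hquad) (h1 u)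
  · exact absurd (by push_cast at hquad ⊢; linear_combination 4 * hquad) (h3 (2 * u - 1))
  · left
    push_cast at hquad
    have : (u - 1) ^ 2 = 0 := by linear_combination hquad
    exact sub_eq_zero.mp (pow_eq_zero_iff two_ne_zero |>.mp this)

/-- If the square of an integer `γ` of `ℚ(√n)` is a unit times a squarefree rational integer `c`,
then `c` is, up to sign, a norm from `ℤ[√n]`, and only ramified primes divide `c`. -/
theorem norm_of_sq_associated (hn : Squarefree n) (hn4 : n % 4 = 2 ∨ n % 4 = 3)
    {δ : Gal(K/ℚ)} (hs : δ B.s = -B.s) (hw : δ B.w = B.w) {γ : 𝓞 K} (hγ : δ • γ = γ) {c : ℕ}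
    (hc : Squarefree c) (h : Associated (γ ^ 2) c) :
    (∃ a b : ℤ, a ^ 2 - n * b ^ 2 = c ∨ a ^ 2 - n * b ^ 2 = -c) ∧
      ∀ r : ℕ, r.Prime → r ∣ c → (r : ℤ) ∣ 2 * n := by
  obtain ⟨τ, hτs, hτw⟩ := B.exists_aut_w
  have hγ' : δ (algebraMap (𝓞 K) K γ) = algebraMap (𝓞 K) K γ := by
    rw [← coe_galois_smul, hγ]
  obtain ⟨a, b, hab⟩ := B.exists_int_coords hn hn4 hs hw γ.isIntegral_coe hγ'
  have hwsq := B.w_sq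
  have hprod : γ * (τ • γ) = ((a ^ 2 - n * b ^ 2 : ℤ) : 𝓞 K) := by
    apply ringOfIntegers_ext
    rw [map_mul, coe_galois_smul, hab]
    simp only [map_add, map_mul, map_intCast, hτw]
    push_cast
    linear_combination (-b ^ 2 : K) * hwsq
  have hassoc : Associated ((a ^ 2 - n * b ^ 2 : ℤ) : 𝓞 K) c := by
    rw [← hprod]
    apply associated_of_sq
    rw [mul_pow, sq (c : 𝓞 K)]
    exact h.mul_mul (galois_smul_sq_associated h τ)
  have hN := eq_or_eq_neg_of_associated hassoc
  refine ⟨⟨a, b, hN⟩, fun r hr hrc => ?_⟩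
  by_contra hrn
  have hpr := Nat.prime_iff_prime_int.mp hr
  have hrcZ : (r : ℤ) ∣ c := by exact_mod_cast hrc
  -- the rational part of `γ ^ 2 / c` is an integer
  have h1 : (c : ℤ) ∣ a ^ 2 + n * b ^ 2 := by
    obtain ⟨y, hy⟩ := h.symm.dvd
    have hc0 : (c : K) ≠ 0 := by exact_mod_cast hc.ne_zero
    have hyK : algebraMap (𝓞 K) K y =
        (((a ^ 2 + n * b ^ 2) / c : ℚ) : K) + ((2 * a * b / c : ℚ) : K) * B.w := by
      have h2 := congrArg (algebraMap (𝓞 K) K) hy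
      rw [map_pow, map_mul, map_natCast] at h2
      rw [hab] at h2
      push_cast
      field_simp
      linear_combination -h2 + (b ^ 2 : K) * hwsq
    obtain ⟨k, _, hk, _⟩ := B.eq_int_of_isIntegral hn hn4 (by rw [← hyK]; exact y.isIntegral_coe)
    have hc0' : (c : ℚ) ≠ 0 := by exact_mod_cast hc.ne_zero
    field_simp at hk
    exact ⟨k, by exact_mod_cast hk⟩
  have hr1 : (r : ℤ) ∣ a ^ 2 + n * b ^ 2 := hrcZ.trans h1
  have hr2 : (r : ℤ) ∣ a ^ 2 - n * b ^ 2 := by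
    rcases hN with h | h <;> rw [h]
    · exact hrcZ
    · exact (dvd_neg).mpr hrcZ
  have hrb : (r : ℤ) ∣ b := by
    have : (r : ℤ) ∣ 2 * n * b ^ 2 := by
      have := dvd_sub hr1 hr2
      rwa [show a ^ 2 + n * b ^ 2 - (a ^ 2 - n * b ^ 2) = 2 * n * b ^ 2 by ring] at this
    exact hpr.dvd_of_dvd_pow ((hpr.dvd_mul.mp this).resolve_left hrn)
  have hra : (r : ℤ) ∣ a := by
    have : (r : ℤ) ∣ a ^ 2 := by
      have h3 : (r : ℤ) ∣ n * b ^ 2 := (hrb.trans (dvd_pow_self b two_ne_zero)).mul_left n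
      have := dvd_add hr2 h3
      rwa [sub_add_cancel] at this
    exact hpr.dvd_of_dvd_pow this
  have hrr : (r : ℤ) * r ∣ c := by
    have h3 : (r : ℤ) * r ∣ a ^ 2 - n * b ^ 2 := by
      rw [← sq]
      exact dvd_sub (pow_dvd_pow_of_dvd hra 2) ((pow_dvd_pow_of_dvd hrb 2).mul_left n)
    rcases hN with h | h
    · rwa [h] at h3
    · rw [h] at h3; exact (dvd_neg).mp h3
  have hrrN : r * r ∣ c := by exact_mod_cast hrr
  exact hr.one_lt.ne' (Nat.isUnit_iff.mp (hc r hrrN))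

/-- In a CM bi-quadratic field not containing `√-1` or `√-3`, an ambiguous principal ideal `(α)`
with `α ^ 2 ~ d` comes from the real quadratic subfield, possibly after multiplication by `√m`
(which exchanges `d` and `d' = -m / d`). Hence `d` or `d'` is up to sign a norm from `ℤ[√n]`. -/
theorem cm_sq_associated (hm0 : m < 0) (hn5 : 5 ≤ n) (hm : Squarefree m) (hn : Squarefree n)
    (hn4 : n % 4 = 2 ∨ n % 4 = 3) (h1 : ∀ z : K, z ^ 2 ≠ (-1 : ℤ)) (h3 : ∀ z : K, z ^ 2 ≠ (-3 : ℤ))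
    {d d' : ℕ} (hd : m = -(d * d' : ℕ)) {α : 𝓞 K} (hα : Associated (α ^ 2) d) :
    ∃ c : ℕ, (c = d ∨ c = d') ∧ (∃ a b : ℤ, a ^ 2 - n * b ^ 2 = c ∨ a ^ 2 - n * b ^ 2 = -c) ∧
      ∀ r : ℕ, r.Prime → r ∣ c → (r : ℤ) ∣ 2 * n := by
  obtain ⟨δ, hs, hw⟩ := B.exists_aut_s
  have hδδ := B.aut_involutive hs hw
  have hsqf : Squarefree (d * d') := by
    rw [← Int.squarefree_natCast]
    rw [hd] at hm
    exact (Int.squarefree_natAbs).mp (by rw [← Int.natAbs_neg]; exact Int.squarefree_natAbs.mpr hm)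
  have hd0 : d ≠ 0 := by rintro rfl; simp at hd; omega
  have hα0 : α ≠ 0 := by
    rintro rfl
    have := hα.eq_zero_iff.mp (by simp)
    exact hd0 (by exact_mod_cast this)
  have hα0K : algebraMap (𝓞 K) K α ≠ 0 := by
    simpa using hα0
  -- the ideal `(α)` is invariant, so complex conjugation multiplies `α` by a unit of norm `1`
  obtain ⟨u, hu⟩ : Associated α (δ • α) :=
    associated_of_sq (hα.trans (galois_smul_sq_associated hα δ).symm)
  set A : K := algebraMap (𝓞 K) K α with hA
  have huK : A * algebraMap (𝓞 K) K u = δ A := by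
    rw [hA, ← coe_galois_smul, ← hu, map_mul]
  have hnorm : algebraMap (𝓞 K) K u * δ (algebraMap (𝓞 K) K u) = 1 := by
    have := congrArg δ huK
    rw [hδδ, map_mul, ← huK] at this
    apply mul_left_cancel₀ hα0K
    linear_combination this
  rcases B.eq_one_or_neg_one_of_norm_one hm0 hn5 hn hn4 h1 h3 hs hw
    (u : 𝓞 K).isIntegral_coe hnorm with h | h
  · refine ⟨d, Or.inl rfl, B.norm_of_sq_associated hn hn4 hs hw (γ := α) ?_
      (hsqf.of_mul_left) hα⟩
    apply ringOfIntegers_ext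
    rw [coe_galois_smul, ← hA, ← huK]
    rw [h, mul_one]
  · have hδA : δ A = -A := by
      rw [← huK, h]; ring
    obtain ⟨v, hv⟩ := hα
    have hd0K : (d : K) ≠ 0 := by exact_mod_cast hd0
    -- `α √m / d` is an integer of the real subfield, of square `~ d'`
    have hsq : (A * B.s / d) ^ 2 * algebraMap (𝓞 K) K v = -d' := by
      have hv' := congrArg (algebraMap (𝓞 K) K) hv
      rw [map_mul, map_pow, map_natCast, ← hA] at hv'
      rw [div_pow, mul_pow, B.s_sq, hd]
      push_cast
      field_simp
      linear_combination -(d' : K) * hv'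
    have hvv : algebraMap (𝓞 K) K v * algebraMap (𝓞 K) K (v⁻¹ : (𝓞 K)ˣ) = 1 := by
      rw [← map_mul, Units.mul_inv, map_one]
    have hint : IsIntegral ℤ (A * B.s / d) := by
      apply IsIntegral.of_pow (n := 2) (by norm_num)
      obtain ⟨y, hy⟩ : ∃ y : 𝓞 K, algebraMap (𝓞 K) K y = (A * B.s / d) ^ 2 := by
        refine ⟨-d' * (v⁻¹ : (𝓞 K)ˣ), ?_⟩
        rw [map_mul, map_neg, map_natCast]
        linear_combination (A * B.s / d) ^ 2 * hvv - algebraMap (𝓞 K) K (v⁻¹ : (𝓞 K)ˣ) * hsq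
      rw [← hy]; exact y.isIntegral_coe
    obtain ⟨γ, hγ⟩ := exists_ringOfIntegers_coe hint
    refine ⟨d', Or.inr rfl, B.norm_of_sq_associated hn hn4 hs hw (γ := γ) ?_
      (hsqf.of_mul_right) ?_⟩
    · apply ringOfIntegers_ext
      rw [coe_galois_smul, hγ, map_div₀, map_mul, hδA, hs, map_natCast]
      ring
    · have : γ ^ 2 * v = -(d' : 𝓞 K) := by
        apply ringOfIntegers_ext
        rw [map_mul, map_pow, hγ, hsq, map_neg, map_natCast]
      have h2 : Associated (γ ^ 2) (-(d' : 𝓞 K)) := ⟨v, this⟩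
      exact h2.neg_right.trans (by rw [neg_neg])

omit B in
theorem _root_.not_isSquare_of_prime {N r : ℤ} (hr : Prime r) (h1 : r ∣ N) (h2 : ¬ r * r ∣ N) :
    ¬ IsSquare N := by
  rintro ⟨k, rfl⟩
  have : r ∣ k := (hr.dvd_mul.mp h1).elim id id
  exact h2 (mul_dvd_mul this this)

/-- A rational integer prime to `r`, where `r` divides `m` exactly once and is prime to `n`, can
become a square in `K` only if it or its product with `n` is a rational square. -/
theorem isSquare_of_prime_dvd {r : ℤ} (hr : Prime r) (hrm : r ∣ m) (hrm2 : ¬ r * r ∣ m)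
    (hrn : ¬ r ∣ n) {e : ℤ} (hre : ¬ r ∣ e) {z : K} (hz : z ^ 2 = e) :
    IsSquare e ∨ IsSquare (e * n) := by
  have key : ∀ t : ℤ, ¬ r ∣ t → ¬ IsSquare (t * m) := by
    intro t ht
    refine not_isSquare_of_prime hr (hrm.mul_left t) fun h => ?_
    obtain ⟨m', rfl⟩ := hrm
    have h3 : r ∣ t * m' := by
      have : r * r ∣ r * (t * m') := by rwa [mul_left_comm]
      exact (mul_dvd_mul_iff_left hr.ne_zero).mp this
    exact hrm2 (mul_dvd_mul_left r ((hr.dvd_mul.mp h3).resolve_left ht))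
  rcases B.rat_square (d := e) (z := z) (by simpa using hz) with h | h | h | h
  · exact Or.inl (Rat.isSquare_intCast_iff.mp h)
  · exact absurd (Rat.isSquare_intCast_iff.mp (by push_cast; exact h)) (key e hre)
  · exact Or.inr (Rat.isSquare_intCast_iff.mp (by push_cast; exact h))
  · refine absurd (Rat.isSquare_intCast_iff.mp ?_)
      (key (e * n) fun h' => (hr.dvd_mul.mp h').elim hre hrn)
    push_cast
    rwa [mul_right_comm] at h

end BiquadraticGens

/-! ### Local conditions at an odd prime -/

section LocalConditions

variable {ℓ : ℕ} [hℓ : Fact ℓ.Prime]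

theorem PadicInt.toZMod_eq_zero_of_norm_lt_one {z : ℤ_[ℓ]} (h : ‖z‖ < 1) :
    PadicInt.toZMod z = 0 := by
  rw [← RingHom.mem_ker, PadicInt.ker_toZMod, IsLocalRing.mem_maximalIdeal]
  exact PadicInt.mem_nonunits.mpr h

/-- Hensel's lemma for squares at an odd prime. -/
theorem PadicInt.isSquare_intCast (h2 : ℓ ≠ 2) {N : ℤ} (hN : ¬ (ℓ : ℤ) ∣ N)
    (hsq : IsSquare (N : ZMod ℓ)) : IsSquare (N : ℤ_[ℓ]) := by
  obtain ⟨k, hk⟩ := hsq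
  obtain ⟨a, rfl⟩ := ZMod.intCast_surjective k
  have hdvd : (ℓ : ℤ) ∣ a * a - N := by
    rw [← ZMod.intCast_zmod_eq_zero_iff_dvd]
    push_cast
    rw [hk, sub_self]
  have hpr := Nat.prime_iff_prime_int.mp hℓ.out
  have h2a : ¬ (ℓ : ℤ) ∣ 2 * a := by
    intro h
    rcases hpr.dvd_mul.mp h with h | h
    · exact h2 ((Nat.prime_dvd_prime_iff_eq hℓ.out Nat.prime_two).mp (by exact_mod_cast h))
    · exact hN (by
        have := dvd_sub (h.mul_right a) hdvd
        rwa [sub_sub_cancel] at this)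
  let F : Polynomial ℤ := Polynomial.X ^ 2 - Polynomial.C N
  have hF : Polynomial.aeval (a : ℤ_[ℓ]) F = ((a * a - N : ℤ) : ℤ_[ℓ]) := by
    simp [F, sq]
  have hF' : Polynomial.aeval (a : ℤ_[ℓ]) (Polynomial.derivative F) = ((2 * a : ℤ) : ℤ_[ℓ]) := by
    simp only [F, Polynomial.derivative_sub, Polynomial.derivative_X_sq, Polynomial.derivative_C,
      sub_zero, map_mul, Polynomial.aeval_X, Polynomial.aeval_C]
    simp
  have h1 : ‖((2 * a : ℤ) : ℤ_[ℓ])‖ = 1 :=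
    le_antisymm (PadicInt.norm_le_one _)
      (not_lt.mp fun h => h2a (PadicInt.norm_intCast_lt_one_iff.mp h))
  obtain ⟨z, hz, -⟩ := hensels_lemma (F := F) (a := (a : ℤ_[ℓ])) (by
    rw [hF, hF', h1, one_pow]
    exact PadicInt.norm_intCast_lt_one_iff.mpr hdvd)
  refine ⟨z, ?_⟩
  have : z ^ 2 - N = 0 := by simpa [F] using hz
  linear_combination -this

/-- The valuations of `x ^ 2` and `ℓ y ^ 2` have different parities. -/
theorem Padic.norm_sq_ne {x y : ℚ_[ℓ]} (hx : x ≠ 0) : ‖x‖ ^ 2 ≠ ‖(ℓ : ℚ_[ℓ])‖ * ‖y‖ ^ 2 := by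
  intro h
  have hℓ0 : (ℓ : ℚ_[ℓ]) ≠ 0 := by exact_mod_cast hℓ.out.ne_zero
  by_cases hy : y = 0
  · subst hy
    simp at h
    exact hx h
  rw [← norm_pow, ← norm_pow, ← norm_mul, Padic.norm_eq_zpow_neg_valuation (pow_ne_zero 2 hx),
    Padic.norm_eq_zpow_neg_valuation (mul_ne_zero hℓ0 (pow_ne_zero 2 hy)),
    Padic.valuation_mul hℓ0 (pow_ne_zero 2 hy), Padic.valuation_pow, Padic.valuation_pow,
    Padic.valuation_p] at h
  have := zpow_right_injective₀ (by exact_mod_cast hℓ.out.pos)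
    (by exact_mod_cast hℓ.out.one_lt.ne') h
  push_cast at this
  omega

theorem Padic.norm_sub_mul_sq_eq_max {m : ℤ} (hm : ¬ (ℓ : ℤ) ∣ m) {x y : ℚ_[ℓ]}
    (h0 : x ≠ 0 ∨ y ≠ 0) : ‖x ^ 2 - ((ℓ * m : ℤ) : ℚ_[ℓ]) * y ^ 2‖ =
      max (‖x‖ ^ 2) (‖(ℓ : ℚ_[ℓ])‖ * ‖y‖ ^ 2) ∧ ‖x‖ ^ 2 ≠ ‖(ℓ : ℚ_[ℓ])‖ * ‖y‖ ^ 2 := by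
  have hm1 : ‖(m : ℚ_[ℓ])‖ = 1 := by
    apply le_antisymm (Padic.norm_int_le_one m)
    by_contra! h
    exact hm (Padic.norm_intCast_lt_one_iff.mp h)
  have hne : ‖x‖ ^ 2 ≠ ‖(ℓ : ℚ_[ℓ])‖ * ‖y‖ ^ 2 := by
    by_cases hx : x = 0
    · subst hx
      have hy := h0.resolve_left (by simp)
      have hℓ0 : (ℓ : ℚ_[ℓ]) ≠ 0 := by exact_mod_cast hℓ.out.ne_zero
      have : 0 < ‖(ℓ : ℚ_[ℓ])‖ * ‖y‖ ^ 2 := by positivity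
      simpa using this.ne
    · exact Padic.norm_sq_ne hx
  have hn : ‖-(((ℓ * m : ℤ) : ℚ_[ℓ]) * y ^ 2)‖ = ‖(ℓ : ℚ_[ℓ])‖ * ‖y‖ ^ 2 := by
    push_cast
    rw [norm_neg, norm_mul, norm_mul, hm1, mul_one, norm_pow]
  refine ⟨?_, hne⟩
  rw [sub_eq_add_neg, Padic.add_eq_max_of_ne (by rw [hn, norm_pow]; exact hne), hn, norm_pow]

/-- Tame symbol at `ℓ`, for `m` prime to `ℓ`: an integer prime to `ℓ` which is a norm from
`ℚ_ℓ(√(ℓ m))` is a square modulo `ℓ`. -/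
theorem isSquare_of_norm_of_not_dvd {m d : ℤ} (hm : ¬ (ℓ : ℤ) ∣ m) (hd : ¬ (ℓ : ℤ) ∣ d)
    {x y : ℚ_[ℓ]} (h : x ^ 2 - ((ℓ * m : ℤ) : ℚ_[ℓ]) * y ^ 2 = d) : IsSquare (d : ZMod ℓ) := by
  have hd1 : ‖(d : ℚ_[ℓ])‖ = 1 := by
    apply le_antisymm (Padic.norm_int_le_one d)
    by_contra! h
    exact hd (Padic.norm_intCast_lt_one_iff.mp h)
  have h0 : x ≠ 0 ∨ y ≠ 0 := by
    by_contra! hc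
    rw [hc.1, hc.2] at h
    rw [← h] at hd1
    simp at hd1
  obtain ⟨hmax, hne⟩ := Padic.norm_sub_mul_sq_eq_max hm h0
  rw [h, hd1] at hmax
  have hy1 : ‖(ℓ : ℚ_[ℓ])‖ * ‖y‖ ^ 2 ≠ 1 := by
    have := Padic.norm_sq_ne (ℓ := ℓ) (x := 1) (y := y) one_ne_zero
    simpa using this.symm
  have hx1 : ‖x‖ ^ 2 = 1 := by
    rcases max_choice (‖x‖ ^ 2) (‖(ℓ : ℚ_[ℓ])‖ * ‖y‖ ^ 2) with hc | hc
    · rw [hc] at hmax; exact hmax.symm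
    · rw [hc] at hmax; exact absurd hmax.symm hy1
  have hy2 : ‖(ℓ : ℚ_[ℓ])‖ * ‖y‖ ^ 2 < 1 :=
    lt_of_le_of_ne (by rw [hmax]; exact le_max_right _ _) hy1
  have hx : ‖x‖ ≤ 1 := (sq_le_one_iff₀ (norm_nonneg x)).mp hx1.le
  let X : ℤ_[ℓ] := ⟨x, hx⟩
  have hlt : ‖X ^ 2 - (d : ℤ_[ℓ])‖ < 1 := by
    rw [PadicInt.norm_def]
    push_cast
    change ‖x ^ 2 - (d : ℚ_[ℓ])‖ < 1
    rw [← h, sub_sub_cancel]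
    push_cast
    rw [norm_mul, norm_mul, norm_pow]
    have hm1 := Padic.norm_int_le_one (p := ℓ) m
    nlinarith [norm_nonneg (m : ℚ_[ℓ]), mul_nonneg (norm_nonneg (ℓ : ℚ_[ℓ])) (sq_nonneg ‖y‖)]
  have := PadicInt.toZMod_eq_zero_of_norm_lt_one hlt
  rw [map_sub, map_pow, map_intCast] at this
  exact ⟨PadicInt.toZMod X, by linear_combination -this⟩

/-- Tame symbol at `ℓ`, for `m` and `d` prime to `ℓ`: if `ℓ d` is a norm from `ℚ_ℓ(√(ℓ m))`, then
`-m d` is a square modulo `ℓ`. -/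
theorem isSquare_of_norm_of_dvd {m d : ℤ} (hm : ¬ (ℓ : ℤ) ∣ m) (hd : ¬ (ℓ : ℤ) ∣ d)
    {x y : ℚ_[ℓ]} (h : x ^ 2 - ((ℓ * m : ℤ) : ℚ_[ℓ]) * y ^ 2 = ((ℓ * d : ℤ) : ℚ_[ℓ])) :
    IsSquare ((-(m * d) : ℤ) : ZMod ℓ) := by
  have hℓ0 : (ℓ : ℚ_[ℓ]) ≠ 0 := by exact_mod_cast hℓ.out.ne_zero
  have hℓpos : 0 < ‖(ℓ : ℚ_[ℓ])‖ := norm_pos_iff.mpr hℓ0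
  have hd1 : ‖(d : ℚ_[ℓ])‖ = 1 := by
    apply le_antisymm (Padic.norm_int_le_one d)
    by_contra! h
    exact hd (Padic.norm_intCast_lt_one_iff.mp h)
  have hdn : ‖((ℓ * d : ℤ) : ℚ_[ℓ])‖ = ‖(ℓ : ℚ_[ℓ])‖ := by
    push_cast
    rw [norm_mul, hd1, mul_one]
  have h0 : x ≠ 0 ∨ y ≠ 0 := by
    by_contra! hc
    rw [hc.1, hc.2] at h
    rw [← h] at hdn
    simp at hdn
    exact hℓ0 (by exact_mod_cast hdn.symm)
  obtain ⟨hmax, hne⟩ := Padic.norm_sub_mul_sq_eq_max hm h0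
  rw [h, hdn] at hmax
  have hx1 : ‖x‖ ^ 2 ≠ ‖(ℓ : ℚ_[ℓ])‖ := by
    by_cases hx : x = 0
    · subst hx; simpa using hℓpos.ne
    · simpa using Padic.norm_sq_ne (ℓ := ℓ) (y := 1) hx
  have hx2 : ‖x‖ ^ 2 < ‖(ℓ : ℚ_[ℓ])‖ :=
    lt_of_le_of_ne (by rw [hmax]; exact le_max_left _ _) hx1
  have hy1 : ‖y‖ ^ 2 = 1 := by
    rcases max_choice (‖x‖ ^ 2) (‖(ℓ : ℚ_[ℓ])‖ * ‖y‖ ^ 2) with hc | hc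
    · rw [hc] at hmax; exact absurd hmax.symm hx1
    · rw [hc] at hmax
      exact mul_left_cancel₀ hℓpos.ne' (by linarith)
  have hy : ‖y‖ ≤ 1 := (sq_le_one_iff₀ (norm_nonneg y)).mp hy1.le
  let Y : ℤ_[ℓ] := ⟨y, hy⟩
  have hlt : ‖(m : ℤ_[ℓ]) * Y ^ 2 + (d : ℤ_[ℓ])‖ < 1 := by
    rw [PadicInt.norm_def]
    push_cast
    change ‖(m : ℚ_[ℓ]) * y ^ 2 + (d : ℚ_[ℓ])‖ < 1
    have : (ℓ : ℚ_[ℓ]) * (m * y ^ 2 + d) = x ^ 2 := by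
      push_cast at h
      linear_combination -h
    have h3 : ‖(ℓ : ℚ_[ℓ])‖ * ‖(m : ℚ_[ℓ]) * y ^ 2 + d‖ = ‖x‖ ^ 2 := by
      rw [← norm_mul, this, norm_pow]
    rw [← h3] at hx2
    by_contra! hc
    nlinarith
  have := PadicInt.toZMod_eq_zero_of_norm_lt_one hlt
  rw [map_add, map_mul, map_pow, map_intCast, map_intCast] at this
  refine ⟨m * PadicInt.toZMod Y, ?_⟩
  push_cast
  linear_combination (-(m : ZMod ℓ)) * this

theorem isSquare_natCast_of_primes {R : Type*} [CommRing R] {a : ℕ} (ha : a ≠ 0)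
    (h : ∀ π : ℕ, π.Prime → π ∣ a → IsSquare (π : R)) : IsSquare (a : R) := by
  rw [← Nat.prod_primeFactorsList ha]
  push_cast
  have : ∀ L : List ℕ, (∀ π ∈ L, IsSquare (π : R)) →
      IsSquare (L.map (fun x : ℕ => (x : R))).prod := by
    intro L
    induction L with
    | nil => intro _; simp
    | cons b L ih =>
      intro hL
      rw [List.map_cons, List.prod_cons]
      exact (hL b (by simp)).mul (ih fun π hπ => hL π (by simp [hπ]))
  exact this _ fun π hπ => h π (Nat.prime_of_mem_primeFactorsList hπ)
    (Nat.dvd_of_mem_primeFactorsList hπ)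

/-- A unit `η = x + y √n` of norm `1` is a square in `ℚ_ℓ` as soon as `-1` and all the primes
dividing `2 n` are: `(1 + η) ^ 2 = 2 (1 + x) η` by Hilbert's Theorem 90, and the squarefree part of
`1 + x` divides `2 n` because `(x + 1) (x - 1) = n y ^ 2`. -/
theorem isSquare_unit_of_norm_one {n x y : ℤ} (hn : n ≠ 0) (h : x ^ 2 - n * y ^ 2 = 1)
    (hneg : IsSquare (-1 : ℤ_[ℓ]))
    (hsq : ∀ π : ℕ, π.Prime → (π : ℤ) ∣ 2 * n → IsSquare (π : ℤ_[ℓ])) {ω : ℤ_[ℓ]}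
    (hω : ω ^ 2 = n) : IsSquare ((x + y * ω : ℤ_[ℓ]) : ℚ_[ℓ]) := by
  have hmap : ∀ {z : ℤ_[ℓ]}, IsSquare z → IsSquare (z : ℚ_[ℓ]) := fun hz =>
    hz.map (PadicInt.Coe.ringHom (p := ℓ))
  by_cases hx : x + 1 = 0
  · have hx' : x = -1 := by omega
    have hy : y = 0 := by
      have : n * y ^ 2 = 0 := by rw [hx'] at h; linarith
      simpa [hn] using this
    apply hmap
    rw [hx', hy]
    simpa using hneg
  obtain ⟨a, b, hab, hsqf⟩ := Nat.sq_mul_squarefree (x + 1).natAbs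
  have hN0 : (x + 1).natAbs ≠ 0 := by omega
  have hb0 : b ≠ 0 := by rintro rfl; simp at hab; omega
  have ha : IsSquare (a : ℤ_[ℓ]) := by
    apply isSquare_natCast_of_primes hsqf.ne_zero
    intro π hπ hπa
    apply hsq π hπ
    by_contra hπn
    have hpr := Nat.prime_iff_prime_int.mp hπ
    have hπ2 : ¬ (π : ℤ) ∣ 2 := fun h' => hπn (h'.mul_right n)
    have hπn' : ¬ (π : ℤ) ∣ n := fun h' => hπn (h'.mul_left 2)
    have hπN : (π : ℤ) ∣ x + 1 := by
      rw [Int.natCast_dvd]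
      rw [← hab]; exact hπa.mul_left _
    have hπM : ¬ (π : ℤ) ∣ x - 1 := by
      intro h'
      apply hπ2
      have := dvd_sub hπN h'
      rwa [show x + 1 - (x - 1) = 2 by ring] at this
    have hM0 : (x - 1).natAbs ≠ 0 := by
      intro h'
      exact hπM (by rw [Int.natAbs_eq_zero.mp h']; exact dvd_zero _)
    have hprod : (x + 1).natAbs * (x - 1).natAbs = n.natAbs * y.natAbs ^ 2 := by
      rw [← Int.natAbs_pow, ← Int.natAbs_mul, ← Int.natAbs_mul]
      congr 1
      linear_combination h
    have hn0 : n.natAbs ≠ 0 := by omega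
    have hy0 : y.natAbs ^ 2 ≠ 0 := by
      intro h'
      rw [h', mul_zero] at hprod
      exact mul_ne_zero hN0 hM0 hprod
    have hfac := congrArg (fun t : ℕ => t.factorization π) hprod
    beta_reduce at hfac
    rw [Nat.factorization_mul hN0 hM0, Nat.factorization_mul hn0 hy0, Nat.factorization_pow,
      ← hab, Nat.factorization_mul (pow_ne_zero 2 hb0) hsqf.ne_zero, Nat.factorization_pow] at hfac
    have e1 : (x - 1).natAbs.factorization π = 0 :=
      Nat.factorization_eq_zero_of_not_dvd (by rwa [← Int.natCast_dvd])
    have e2 : n.natAbs.factorization π = 0 :=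
      Nat.factorization_eq_zero_of_not_dvd (by rwa [← Int.natCast_dvd])
    have e3 : a.factorization π = 1 := by
      have h1 := (Nat.squarefree_iff_factorization_le_one hsqf.ne_zero).mp hsqf π
      have h2 := hπ.factorization_pos_of_dvd hsqf.ne_zero hπa
      omega
    simp only [Finsupp.add_apply, Finsupp.smul_apply, smul_eq_mul] at hfac
    omega
  have hx1 : IsSquare ((x + 1 : ℤ) : ℤ_[ℓ]) := by
    have hnat : IsSquare (((x + 1).natAbs : ℕ) : ℤ_[ℓ]) := by
      rw [← hab]
      push_cast
      exact (IsSquare.sq _).mul ha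
    rcases Int.natAbs_eq (x + 1) with h' | h'
    · rw [h', Int.cast_natCast]; exact hnat
    · rw [h', Int.cast_neg, Int.cast_natCast, ← neg_one_mul]
      exact hneg.mul hnat
  have h2 : IsSquare ((2 : ℕ) : ℤ_[ℓ]) := hsq 2 Nat.prime_two ⟨n, by push_cast; ring⟩
  have hden : IsSquare (((2 : ℕ) * ((x + 1 : ℤ) : ℤ_[ℓ]) : ℤ_[ℓ]) : ℚ_[ℓ]) := hmap (h2.mul hx1)
  have hden0 : (((2 : ℕ) * ((x + 1 : ℤ) : ℤ_[ℓ]) : ℤ_[ℓ]) : ℚ_[ℓ]) ≠ 0 := by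
    push_cast
    have : ((x + 1 : ℤ) : ℚ_[ℓ]) ≠ 0 := by exact_mod_cast hx
    push_cast at this
    simpa using this
  have hnum : ((x + y * ω : ℤ_[ℓ]) : ℚ_[ℓ]) =
      (1 + ((x + y * ω : ℤ_[ℓ]) : ℚ_[ℓ])) ^ 2 /
        (((2 : ℕ) * ((x + 1 : ℤ) : ℤ_[ℓ]) : ℤ_[ℓ]) : ℚ_[ℓ]) := by
    rw [eq_div_iff hden0]
    have hZ : (x + y * ω : ℤ_[ℓ]) * ((2 : ℕ) * ((x + 1 : ℤ) : ℤ_[ℓ])) =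
        (1 + (x + y * ω : ℤ_[ℓ])) ^ 2 := by
      have h' : (x : ℤ_[ℓ]) ^ 2 - n * y ^ 2 = 1 := by
        exact_mod_cast congrArg (Int.cast (R := ℤ_[ℓ])) h
      push_cast
      linear_combination h' - (y : ℤ_[ℓ]) ^ 2 * hω
    exact_mod_cast congrArg (fun t : ℤ_[ℓ] => (t : ℚ_[ℓ])) hZ
  rw [hnum]
  exact (IsSquare.sq _).div hden

end LocalConditions

/-! ### A local condition for ambiguous principal ideals of real fields -/

namespace BiquadraticGens

variable {K : Type*} [Field K] [NumberField K] {m n : ℤ} (B : BiquadraticGens K m n)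

include B

/-- Let `ℚ(√n)` be a real quadratic field without units of norm `-1`. If `d` is a unit times the
square of an algebraic integer of `K`, then, at every odd prime `ℓ` such that `-1` and the primes
dividing `2 n` are squares in `ℤ_ℓ`, it is a norm from `ℚ_ℓ(√m)`. -/
theorem exists_padic_norm (hn : Squarefree n) (hn4 : n % 4 = 2 ∨ n % 4 = 3) (hn0 : 0 < n)
    (hneg : ∀ x y : ℤ, x ^ 2 - n * y ^ 2 ≠ -1) {d : ℕ} (hd0 : d ≠ 0) {α : 𝓞 K}
    (hα : Associated (α ^ 2) d) {ℓ : ℕ} [Fact ℓ.Prime] (hneg' : IsSquare (-1 : ℤ_[ℓ]))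
    (hsq : ∀ π : ℕ, π.Prime → (π : ℤ) ∣ 2 * n → IsSquare (π : ℤ_[ℓ])) :
    ∃ x y : ℚ_[ℓ], x ^ 2 - (m : ℚ_[ℓ]) * y ^ 2 = d := by
  obtain ⟨δ, hs, hw⟩ := B.exists_aut_s
  obtain ⟨τ, hτs, hτw⟩ := B.exists_aut_w
  have hwsq := B.w_sq
  have hssq := B.s_sq
  have hδδ := B.aut_involutive hs hw
  have hd0K : (d : K) ≠ 0 := by exact_mod_cast hd0
  -- the relative norm of `α` is `d η` for a unit `η` of `ℚ(√n)`
  have hassoc : Associated (d : 𝓞 K) (α * δ • α) := by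
    apply associated_of_sq
    rw [mul_pow, sq (d : 𝓞 K)]
    exact (hα.mul_mul (galois_smul_sq_associated hα δ)).symm
  obtain ⟨η, hη⟩ := hassoc
  set A : K := algebraMap (𝓞 K) K α with hA
  have hηK : (d : K) * algebraMap (𝓞 K) K η = A * δ A := by
    rw [hA, ← coe_galois_smul, ← map_mul, ← hη, map_mul, map_natCast]
  have hηfix : δ (algebraMap (𝓞 K) K η) = algebraMap (𝓞 K) K η := by
    have := congrArg δ hηK
    rw [map_mul, map_mul, map_natCast, hδδ, mul_comm (δ A), ← hηK] at this
    exact mul_left_cancel₀ hd0K this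
  obtain ⟨x, y, hxy⟩ := B.exists_int_coords hn hn4 hs hw (η : 𝓞 K).isIntegral_coe hηfix
  have hnorm : x ^ 2 - n * y ^ 2 = 1 := by
    have hprod : (η : 𝓞 K) * (τ • (η : 𝓞 K)) = ((x ^ 2 - n * y ^ 2 : ℤ) : 𝓞 K) := by
      apply ringOfIntegers_ext
      rw [map_mul, coe_galois_smul, hxy]
      simp only [map_add, map_mul, map_intCast, hτw]
      push_cast
      linear_combination (-y ^ 2 : K) * hwsq
    have hunit : IsUnit ((x ^ 2 - n * y ^ 2 : ℤ) : 𝓞 K) := by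
      rw [← hprod]
      refine η.isUnit.mul ?_
      have : Associated (η : 𝓞 K) 1 := associated_one_iff_isUnit.mpr η.isUnit
      have := associated_galois_smul this τ
      rw [smul_one] at this
      exact associated_one_iff_isUnit.mp this
    rcases eq_or_eq_neg_of_associated (c := 1)
      (by rw [Nat.cast_one]; exact associated_one_iff_isUnit.mpr hunit) with h | h
    · simpa using h
    · exact absurd (by simpa using h) (hneg x y)
  obtain ⟨a, b, c, e, hcoord⟩ := B.coords A
  have hδA : δ A = a - b * B.s + c * B.w - e * (B.s * B.w) := by
    rw [hcoord]
    simp only [map_add, map_mul, map_ratCast, hs, hw]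
    ring
  have hzero : ((a ^ 2 + n * c ^ 2 - m * (b ^ 2 + n * e ^ 2) - d * x : ℚ) : K) +
      ((2 * a * c - 2 * m * b * e - d * y : ℚ) : K) * B.w = 0 := by
    rw [hδA, hcoord, hxy] at hηK
    push_cast
    rw [← hwsq, ← hssq]
    linear_combination -hηK
  obtain ⟨hr1, hr2⟩ := B.coords_two_eq_zero hzero
  have hr1' := congrArg (Rat.cast (K := ℚ_[ℓ])) hr1
  have hr2' := congrArg (Rat.cast (K := ℚ_[ℓ])) hr2
  push_cast at hr1' hr2'
  -- transport the norm equation to `ℚ_ℓ`, where `η` becomes a square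
  have hnsq : IsSquare ((n.natAbs : ℕ) : ℤ_[ℓ]) := by
    apply isSquare_natCast_of_primes (by omega)
    intro π hπ hπn
    exact hsq π hπ ((Int.natCast_dvd.mpr hπn).mul_left 2)
  obtain ⟨ω, hω⟩ := hnsq
  have hω' : ω ^ 2 = (n : ℤ_[ℓ]) := by
    rw [sq, ← hω, ← Int.cast_natCast, Int.natAbs_of_nonneg hn0.le]
  obtain ⟨ρ, hρ⟩ := isSquare_unit_of_norm_one hn0.ne' hnorm hneg' hsq hω'
  have hωQ : (ω : ℚ_[ℓ]) ^ 2 = n := by exact_mod_cast congrArg (fun t : ℤ_[ℓ] => (t : ℚ_[ℓ])) hω'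
  push_cast at hρ
  have hρ0 : ρ ≠ 0 := by
    rintro rfl
    have h1 : ((x : ℚ_[ℓ]) + y * ω) * (x - y * ω) = 1 := by
      have h' : (x : ℚ_[ℓ]) ^ 2 - n * y ^ 2 = 1 := by
        exact_mod_cast congrArg (Int.cast (R := ℚ_[ℓ])) hnorm
      linear_combination h' - (y : ℚ_[ℓ]) ^ 2 * hωQ
    rw [hρ] at h1
    simp at h1
  refine ⟨(a + c * ω) / ρ, (b + e * ω) / ρ, ?_⟩
  field_simp
  rw [sq ρ, ← hρ]
  linear_combination hr1' + (ω : ℚ_[ℓ]) * hr2' + ((c : ℚ_[ℓ]) ^ 2 - m * e ^ 2) * hωQ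

end BiquadraticGens

/-! ### The rank of the Pólya group -/

namespace BiquadraticGens

variable {K : Type*} [Field K] [NumberField K] {m n : ℤ} (B : BiquadraticGens K m n)

include B

/-- An element of `ℤ[√n]` of norm `± 2` generates an ideal of square `(2)`. -/
theorem associated_two_of_norm {x y : ℤ} (h : x ^ 2 - n * y ^ 2 = 2 ∨ x ^ 2 - n * y ^ 2 = -2) :
    ∃ z : 𝓞 K, Associated (z ^ 2) ((2 : ℕ) : 𝓞 K) := by
  obtain ⟨e, he, hxy⟩ : ∃ e : ℤ, e ^ 2 = 1 ∧ x ^ 2 - n * y ^ 2 = 2 * e := by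
    rcases h with h | h
    · exact ⟨1, by norm_num, by rw [h]; norm_num⟩
    · exact ⟨-1, by norm_num, by rw [h]; norm_num⟩
  have hw := B.wInt_sq
  have he' : (e : 𝓞 K) ^ 2 = 1 := by exact_mod_cast congrArg (Int.cast (R := 𝓞 K)) he
  have hxy' : (x : 𝓞 K) ^ 2 - n * y ^ 2 = 2 * e := by
    exact_mod_cast congrArg (Int.cast (R := 𝓞 K)) hxy
  -- `(x + y √n) ^ 2 = 2 ε` with `ε = e + n y ^ 2 + x y √n` of norm `1`
  have hunit : (e + n * y ^ 2 + x * y * B.wInt : 𝓞 K) * (e + n * y ^ 2 - x * y * B.wInt) = 1 := by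
    linear_combination he' - (x : 𝓞 K) ^ 2 * y ^ 2 * hw - (n : 𝓞 K) * y ^ 2 * hxy'
  refine ⟨x + y * B.wInt, Associated.symm ⟨Units.mkOfMulEqOne _ _ hunit, ?_⟩⟩
  rw [Units.val_mkOfMulEqOne]
  push_cast
  linear_combination -(y : 𝓞 K) ^ 2 * hw - hxy'

omit B [NumberField K] in
theorem _root_.associated_intCast_natAbs (a : ℤ) : Associated (a : 𝓞 K) (a.natAbs : 𝓞 K) := by
  rcases Int.natAbs_eq a with h | h
  · conv_lhs => rw [h]
    rw [Int.cast_natCast]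
  · conv_lhs => rw [h]
    rw [Int.cast_neg, Int.cast_natCast]
    exact (Associated.refl _).neg_left

/-- If `m = ± e s₁ ⋯ s_r` for distinct primes, the classes at `s₁, …, s_r` generate the Pólya group
of `ℚ(√m, √n)` as soon as `√m`, `√n` (and an element of norm `± 2` of `ℤ[√n]`) provide the relations
eliminating the other ramified primes. If moreover no product of distinct `s i` is a unit times a
square, the Pólya group is elementary abelian of rank `r`. -/
theorem nonempty_polyaGroup_mulEquiv (hm : Squarefree m) (hn : Squarefree n) (hm4 : m % 4 = 1)
    (hn4 : n % 4 = 2 ∨ n % 4 = 3) {r : ℕ} {s : Fin r → ℕ} (hs : ∀ i, (s i).Prime)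
    (hinj : Function.Injective s) {e : ℕ} (he : e.Prime) (hes : ∀ i, s i ≠ e)
    (hmes : m.natAbs = e * ∏ i, s i)
    (hrel : (∃ p : ℕ, p.Prime ∧ n = p ∧
        ∃ x y : ℤ, x ^ 2 - n * y ^ 2 = 2 ∨ x ^ 2 - n * y ^ 2 = -2) ∨
      (∃ q : ℕ, q.Prime ∧ n = 2 * q ∧
        ((∃ x y : ℤ, x ^ 2 - n * y ^ 2 = 2 ∨ x ^ 2 - n * y ^ 2 = -2) ∨ q = e)))
    (hind : ∀ S : Finset (Fin r), S.Nonempty → ∀ α : 𝓞 K,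
      ¬ Associated (α ^ 2) ((∏ i ∈ S, s i : ℕ) : 𝓞 K)) :
    Nonempty (polyaGroup K ≃* Multiplicative (Fin r → ZMod 2)) := by
  obtain ⟨c, hpol, hc⟩ := B.exists_polya_classes hm hn hm4 hn4
  have hm0 : m.natAbs ≠ 0 := by simpa using hm.ne_zero
  have hn0 : n.natAbs ≠ 0 := by simpa using hn.ne_zero
  have hsm : ∀ i, (s i : ℤ) ∣ m := fun i => by
    rw [Int.natCast_dvd, hmes]
    exact (Finset.dvd_prod_of_mem s (Finset.mem_univ i)).mul_left e
  have hsd : ∀ i, (s i : ℤ) ∣ 2 * m * n := fun i => ((hsm i).mul_left 2).mul_right n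
  have hprod : ∀ S : Finset (Fin r), ∏ ℓ ∈ S.image s, c ℓ = ∏ i ∈ S, c (s i) := fun S =>
    Finset.prod_image fun i _ j _ h => hinj h
  have hprod' : ∀ S : Finset (Fin r), ∏ ℓ ∈ S.image s, ℓ = ∏ i ∈ S, s i := fun S =>
    Finset.prod_image fun i _ j _ h => hinj h
  have hU : ∀ S : Finset (Fin r), ∀ ℓ ∈ S.image s, ℓ.Prime ∧ (ℓ : ℤ) ∣ 2 * m * n := by
    intro S ℓ hℓ
    obtain ⟨i, _, rfl⟩ := Finset.mem_image.mp hℓ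
    exact ⟨hs i, hsd i⟩
  refine nonempty_mulEquiv_zmod_two (fun i => c (s i)) ?_ ?_ ?_
  · intro i
    simpa using (hc {s i} (by simpa using ⟨hs i, hsd i⟩)).1
  · intro S hS h1
    rw [← hprod] at h1
    obtain ⟨α, hα⟩ := (hc _ (hU S)).2.mp h1
    rw [hprod'] at hα
    exact hind S hS α hα
  · rw [hpol]
    apply le_antisymm
    swap
    · apply Subgroup.closure_mono
      rintro _ ⟨i, rfl⟩
      exact ⟨s i, hs i, hsd i, rfl⟩
    rw [Subgroup.closure_le]
    set H := Subgroup.closure (Set.range fun i => c (s i)) with hH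
    have hsH : ∀ i, c (s i) ∈ H := fun i => Subgroup.subset_closure ⟨i, rfl⟩
    -- the three relations
    have relm : ∏ ℓ ∈ m.natAbs.primeFactors, c ℓ = 1 := by
      refine (hc _ fun ℓ hℓ => ⟨Nat.prime_of_mem_primeFactors hℓ, ?_⟩).2.mpr ⟨B.sInt, ?_⟩
      · exact ((Int.natCast_dvd.mpr (Nat.dvd_of_mem_primeFactors hℓ)).mul_left 2).mul_right n
      · rw [Nat.prod_primeFactors_of_squarefree (Int.squarefree_natAbs.mpr hm), B.sInt_sq]
        exact associated_intCast_natAbs m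
    have reln : ∏ ℓ ∈ n.natAbs.primeFactors, c ℓ = 1 := by
      refine (hc _ fun ℓ hℓ => ⟨Nat.prime_of_mem_primeFactors hℓ, ?_⟩).2.mpr ⟨B.wInt, ?_⟩
      · exact (Int.natCast_dvd.mpr (Nat.dvd_of_mem_primeFactors hℓ)).mul_left _
      · rw [Nat.prod_primeFactors_of_squarefree (Int.squarefree_natAbs.mpr hn), B.wInt_sq]
        exact associated_intCast_natAbs n
    have rel2 : (∃ x y : ℤ, x ^ 2 - n * y ^ 2 = 2 ∨ x ^ 2 - n * y ^ 2 = -2) → c 2 = 1 := by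
      rintro ⟨x, y, h⟩
      have h2 := (hc {2} (by
        simp only [Finset.mem_singleton, forall_eq]
        exact ⟨Nat.prime_two, by rw [mul_assoc]; exact dvd_mul_right _ _⟩)).2
      simp only [Finset.prod_singleton] at h2
      exact h2.mpr (B.associated_two_of_norm h)
    have hmfac : ∀ ℓ ∈ m.natAbs.primeFactors, ℓ = e ∨ c ℓ ∈ H := by
      intro ℓ hℓ
      have hℓp := Nat.prime_of_mem_primeFactors hℓ
      have hd := Nat.dvd_of_mem_primeFactors hℓ
      rw [hmes] at hd
      rcases hℓp.prime.dvd_mul.mp hd with h | h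
      · exact Or.inl ((Nat.prime_dvd_prime_iff_eq hℓp he).mp h)
      · obtain ⟨i, _, hi⟩ := hℓp.prime.exists_mem_finset_dvd h
        rw [(Nat.prime_dvd_prime_iff_eq hℓp (hs i)).mp hi]
        exact Or.inr (hsH i)
    have heH : c e ∈ H := by
      apply H.mem_of_prod_mem (by rw [relm]; exact H.one_mem) (i := e)
      · rw [Nat.mem_primeFactors]
        exact ⟨he, by rw [hmes]; exact dvd_mul_right _ _, hm0⟩
      · intro ℓ hℓ hne
        exact (hmfac ℓ hℓ).resolve_left hne
    have hmH : ∀ ℓ ∈ m.natAbs.primeFactors, c ℓ ∈ H := by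
      intro ℓ hℓ
      rcases hmfac ℓ hℓ with rfl | h
      · exact heH
      · exact h
    have h2n : c 2 ∈ H ∧ ∀ ℓ ∈ n.natAbs.primeFactors, c ℓ ∈ H := by
      rcases hrel with ⟨p, hp, rfl, hx⟩ | ⟨q, hq, rfl, hx⟩
      · refine ⟨by rw [rel2 hx]; exact H.one_mem, fun ℓ hℓ => ?_⟩
        rw [Int.natAbs_natCast, hp.primeFactors] at hℓ reln
        rw [Finset.prod_singleton] at reln
        rw [Finset.mem_singleton.mp hℓ, reln]
        exact H.one_mem
      · have hfac : ((2 * q : ℤ)).natAbs.primeFactors = {2, q} := by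
          rw [Int.natAbs_mul, Int.natAbs_natCast]
          rw [Nat.primeFactors_mul (by norm_num) hq.ne_zero, hq.primeFactors]
          change Nat.primeFactors 2 ∪ {q} = _
          rw [Nat.prime_two.primeFactors]
          rfl
        rw [hfac] at reln ⊢
        have hreln : ∏ ℓ ∈ ({2, q} : Finset ℕ), c ℓ ∈ H := by rw [reln]; exact H.one_mem
        rcases hx with hx | rfl
        · have h2H : c 2 ∈ H := by rw [rel2 hx]; exact H.one_mem
          have hqH : c q ∈ H := by
            refine H.mem_of_prod_mem hreln (i := q) (by simp) fun j hj hne => ?_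
            rcases Finset.mem_insert.mp hj with rfl | hj
            · exact h2H
            · exact absurd (Finset.mem_singleton.mp hj) hne
          refine ⟨h2H, ?_⟩
          simpa using ⟨h2H, hqH⟩
        · have h2H : c 2 ∈ H := by
            refine H.mem_of_prod_mem hreln (i := 2) (by simp) fun j hj hne => ?_
            rcases Finset.mem_insert.mp hj with rfl | hj
            · exact absurd rfl hne
            · rw [Finset.mem_singleton.mp hj]; exact heH
          refine ⟨h2H, ?_⟩
          simpa using ⟨h2H, heH⟩
    rintro _ ⟨ℓ, hℓ, hd, rfl⟩
    have hpr := Nat.prime_iff_prime_int.mp hℓ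
    rcases hpr.dvd_mul.mp hd with h | h
    · rcases hpr.dvd_mul.mp h with h | h
      · have : ℓ = 2 := (Nat.prime_dvd_prime_iff_eq hℓ Nat.prime_two).mp (by exact_mod_cast h)
        rw [this]; exact h2n.1
      · exact hmH ℓ (Nat.mem_primeFactors.mpr ⟨hℓ, Int.natCast_dvd.mp h, hm0⟩)
    · exact h2n.2 ℓ (Nat.mem_primeFactors.mpr ⟨hℓ, Int.natCast_dvd.mp h, hn0⟩)

/-- Independence of the classes in the CM case `m = -e s₁ ⋯ s_r`. By `cm_sq_associated`, either the
product over `S` or the complementary divisor of `m` is a norm up to sign and has only prime factors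
dividing `2 n`; the primes `s i` do not divide `2 n`, and `hen` excludes the remaining value `e`. -/
theorem not_sq_associated_of_cm (hm : Squarefree m) (hn : Squarefree n)
    (hn4 : n % 4 = 2 ∨ n % 4 = 3) (hn5 : 5 ≤ n) {r : ℕ} {s : Fin r → ℕ} (hs : ∀ i, (s i).Prime)
    (hs3 : ∀ i, 3 < s i) (hsn : ∀ i, ¬ (s i : ℤ) ∣ 2 * n) {e : ℕ} (he : e.Prime)
    (hmes : m = -(e * ∏ i, s i : ℕ))
    (hen : ¬ (e : ℤ) ∣ 2 * n ∨ ∀ a b : ℤ, a ^ 2 - n * b ^ 2 ≠ e ∧ a ^ 2 - n * b ^ 2 ≠ -e)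
    {S : Finset (Fin r)} (hS : S.Nonempty) (α : 𝓞 K) :
    ¬ Associated (α ^ 2) ((∏ i ∈ S, s i : ℕ) : 𝓞 K) := by
  intro hα
  obtain ⟨i₀, hi₀⟩ := hS
  have hm0 : m < 0 := by
    have : 0 < e * ∏ i, s i := Nat.mul_pos he.pos (Finset.prod_pos fun i _ => (hs i).pos)
    omega
  have hpr := Nat.prime_iff_prime_int.mp (hs i₀)
  have hrm : (s i₀ : ℤ) ∣ m := by
    rw [hmes, dvd_neg, Int.natCast_dvd_natCast]
    exact (Finset.dvd_prod_of_mem s (Finset.mem_univ i₀)).mul_left e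
  have hrm2 : ¬ (s i₀ : ℤ) * s i₀ ∣ m := fun h => hpr.not_isUnit (hm _ h)
  have hrn : ¬ (s i₀ : ℤ) ∣ n := fun h => hsn i₀ (h.mul_left 2)
  have nosq : ∀ t : ℤ, 0 < t → t ≤ 3 → ∀ z : K, z ^ 2 ≠ (-t : ℤ) := by
    intro t ht ht3 z hz
    have hne : ¬ (s i₀ : ℤ) ∣ -t := by
      rw [dvd_neg]
      intro h
      have := Int.le_of_dvd ht h
      have := hs3 i₀
      omega
    rcases B.isSquare_of_prime_dvd hpr hrm hrm2 hrn hne hz with ⟨k, hk⟩ | ⟨k, hk⟩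
    · nlinarith [mul_self_nonneg k]
    · nlinarith [mul_self_nonneg k]
  have hmd : m = -((∏ i ∈ S, s i) * (e * ∏ i ∈ Sᶜ, s i) : ℕ) := by
    rw [hmes, mul_left_comm, Finset.prod_mul_prod_compl]
  obtain ⟨c, hcd, ⟨a, b, hab⟩, hdiv⟩ := B.cm_sq_associated hm0 hn5 hm hn hn4
    (nosq 1 (by norm_num) (by norm_num)) (nosq 3 (by norm_num) (by norm_num)) hmd hα
  rcases hcd with rfl | rfl
  · exact hsn i₀ (hdiv _ (hs i₀) (Finset.dvd_prod_of_mem s hi₀))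
  · rcases hen with hen | hen
    · exact hen (hdiv e he (dvd_mul_right _ _))
    · rcases (Sᶜ).eq_empty_or_nonempty with h | ⟨j, hj⟩
      · rw [h, Finset.prod_empty, mul_one] at hab
        exact hab.elim (hen a b).1 (hen a b).2
      · exact hsn j (hdiv _ (hs j) ((Finset.dvd_prod_of_mem s hj).mul_left e))

omit B in
/-- A product of non-residues is a residue only if the number of factors is even. -/
theorem _root_.even_card_of_isSquare_prod {ι : Type*} {ℓ : ℕ} [Fact ℓ.Prime] (A : Finset ι)
    (T : ι → ℕ) (hT : ∀ i ∈ A, ¬ IsSquare (T i : ZMod ℓ))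
    (h : IsSquare ((∏ i ∈ A, T i : ℕ) : ZMod ℓ)) : Even A.card := by
  classical
  by_cases h2 : ringChar (ZMod ℓ) = 2
  · rcases A.eq_empty_or_nonempty with rfl | ⟨i, hi⟩
    · simp
    · exact absurd (FiniteField.isSquare_of_char_two h2 _) (hT i hi)
  have h1 : quadraticChar (ZMod ℓ) ((∏ i ∈ A, T i : ℕ) : ZMod ℓ) = (-1) ^ A.card := by
    push_cast
    rw [map_prod]
    apply Finset.prod_eq_pow_card
    intro i hi
    exact quadraticChar_neg_one_iff_not_isSquare.mpr (hT i hi)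
  by_contra hodd
  rw [Nat.not_even_iff_odd] at hodd
  rw [hodd.neg_one_pow] at h1
  exact quadraticChar_neg_one_iff_not_isSquare.mp h1 h

/-- Independence of the classes in the real case: `m` is the product of an odd number of primes
which are pairwise non-residues, and `d` the product of a nonempty proper subfamily. At a prime
outside the subfamily the local condition makes the number of primes in `d` even, at a prime of the
subfamily it makes the number of remaining primes even. -/
theorem not_sq_associated_of_real (hm : Squarefree m) (hn : Squarefree n)
    (hn4 : n % 4 = 2 ∨ n % 4 = 3) (hn0 : 0 < n) (hneg : ∀ x y : ℤ, x ^ 2 - n * y ^ 2 ≠ -1)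
    {t : ℕ} (ht : Odd t) {T : Fin t → ℕ} (hT : ∀ i, (T i).Prime) (hT4 : ∀ i, T i % 4 = 1)
    (hTn : ∀ i, ¬ (T i : ℤ) ∣ 2 * n)
    (hTsq : ∀ i, ∀ π : ℕ, π.Prime → (π : ℤ) ∣ 2 * n → IsSquare (π : ZMod (T i)))
    (hres : ∀ i j, i ≠ j → ¬ IsSquare (T i : ZMod (T j))) (hmT : m = (∏ i, T i : ℕ))
    {S : Finset (Fin t)} (hS : S.Nonempty) (hSu : S ≠ Finset.univ) (α : 𝓞 K) :
    ¬ Associated (α ^ 2) ((∏ i ∈ S, T i : ℕ) : 𝓞 K) := by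
  intro hα
  have hd0 : ∏ i ∈ S, T i ≠ 0 := Finset.prod_ne_zero_iff.mpr fun i _ => (hT i).ne_zero
  have hsplit := Finset.prod_mul_prod_compl S T
  have hF : ∀ j, Fact (T j).Prime := fun j => ⟨hT j⟩
  have hlocal : ∀ j, ∃ x y : ℚ_[T j], x ^ 2 - (m : ℚ_[T j]) * y ^ 2 = (∏ i ∈ S, T i : ℕ) := by
    intro j
    have hodd : T j ≠ 2 := fun h => by have := hT4 j; omega
    refine B.exists_padic_norm hn hn4 hn0 hneg hd0 hα ?_ ?_
    · have h1 : IsSquare ((-1 : ℤ) : ℤ_[T j]) := by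
        apply PadicInt.isSquare_intCast hodd
        · rw [dvd_neg]
          exact fun h => (Nat.prime_iff_prime_int.mp (hT j)).not_isUnit (isUnit_of_dvd_one h)
        · push_cast
          exact ZMod.exists_sq_eq_neg_one_iff.mpr (by have := hT4 j; omega)
      simpa using h1
    · intro π hπ hπn
      have h1 : IsSquare ((π : ℤ) : ℤ_[T j]) := by
        apply PadicInt.isSquare_intCast hodd
        · intro h
          have h' : T j = π := (Nat.prime_dvd_prime_iff_eq (hT j) hπ).mp (by exact_mod_cast h)
          exact hTn j (by rw [h']; exact hπn)
        · exact_mod_cast hTsq j π hπ hπn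
      exact_mod_cast h1
  -- a prime outside `S`
  obtain ⟨j, hj⟩ : ∃ j, j ∉ S := by
    by_contra! h
    exact hSu (Finset.eq_univ_iff_forall.mpr h)
  have hevenS : Even S.card := by
    obtain ⟨x, y, hxy⟩ := hlocal j
    have hmj : m = T j * (∏ i ∈ Finset.univ.erase j, T i : ℕ) := by
      rw [hmT, ← Finset.mul_prod_erase _ _ (Finset.mem_univ j)]; push_cast; ring
    have hmj' : ¬ (T j : ℤ) ∣ (∏ i ∈ Finset.univ.erase j, T i : ℕ) :=
      not_dvd_of_squarefree_mul (hT j) (by rw [← hmj]; exact hm)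
    rw [hmj] at hxy
    have hsq := isSquare_of_norm_of_not_dvd (d := (∏ i ∈ S, T i : ℕ)) hmj' ?_ (by
      rw [hxy]; push_cast; rfl)
    · exact even_card_of_isSquare_prod S T (fun i hi => hres i j (by rintro rfl; exact hj hi))
        (by exact_mod_cast hsq)
    · intro h
      rw [Int.natCast_dvd_natCast] at h
      obtain ⟨i, hi, hij⟩ := (hT j).prime.exists_mem_finset_dvd h
      apply hmj'
      rw [Int.natCast_dvd_natCast]
      exact hij.trans (Finset.dvd_prod_of_mem T (by
        rw [Finset.mem_erase]; exact ⟨by rintro rfl; exact hj hi, Finset.mem_univ _⟩))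
  -- a prime in `S`
  obtain ⟨k, hk⟩ := hS
  have hevenC : Even (Sᶜ).card := by
    obtain ⟨x, y, hxy⟩ := hlocal k
    set d' : ℕ := ∏ i ∈ S.erase k, T i with hd'
    set b : ℕ := ∏ i ∈ Sᶜ, T i with hb
    have hdk : ∏ i ∈ S, T i = T k * d' := (Finset.mul_prod_erase _ _ hk).symm
    have hmk : m = T k * ((d' * b : ℕ) : ℤ) := by
      rw [hmT, ← hsplit, hdk]; push_cast; ring
    have hmk' : ¬ (T k : ℤ) ∣ (d' * b : ℕ) :=
      not_dvd_of_squarefree_mul (hT k) (by rw [← hmk]; exact hm)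
    have hdk' : ¬ (T k : ℤ) ∣ d' := fun h => hmk' (by push_cast; exact h.mul_right _)
    rw [hmk, hdk] at hxy
    have hsq := isSquare_of_norm_of_dvd (d := d') hmk' hdk' (by rw [hxy]; push_cast; rfl)
    apply even_card_of_isSquare_prod (ℓ := T k) Sᶜ T
      (fun i hi => hres i k (by rintro rfl; exact Finset.mem_compl.mp hi hk))
    have hd0' : (d' : ZMod (T k)) ≠ 0 := by
      intro h
      apply hdk'
      rw [← ZMod.intCast_zmod_eq_zero_iff_dvd]
      exact_mod_cast h
    have hm1 : IsSquare (-1 : ZMod (T k)) :=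
      ZMod.exists_sq_eq_neg_one_iff.mpr (by have := hT4 k; omega)
    have hfin := (hm1.mul hsq).div (IsSquare.sq (d' : ZMod (T k)))
    rw [← hb]
    have heq :
        -1 * ((-((d' * b : ℕ) * (d' : ℤ)) : ℤ) : ZMod (T k)) / (d' : ZMod (T k)) ^ 2 = b := by
      rw [div_eq_iff (pow_ne_zero 2 hd0')]
      push_cast
      ring
    rwa [heq] at hfin
  have hcard : S.card + (Sᶜ).card = t := by
    rw [Finset.card_add_card_compl, Fintype.card_fin]
  rw [← hcard] at ht
  exact (Nat.not_even_iff_odd.mpr ht) (hevenS.add hevenC)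

end BiquadraticGens

/-! ### Choice of the primes -/

theorem Nat.Coprime.of_modEq_one {a M : ℕ} (h : a ≡ 1 [MOD M]) : a.Coprime M := by
  rw [Nat.Coprime, h.gcd_eq]
  exact Nat.gcd_one_left M

/-- Arbitrarily large primes congruent to `1` modulo a given multiple of `4` which are pairwise
quadratic non-residues: each new prime is found by Dirichlet's theorem in a residue class modulo the
previous ones, and quadratic reciprocity makes the condition symmetric. -/
theorem exists_primes_pairwise_not_isSquare {M : ℕ} (hM : M ≠ 0) (h4 : 4 ∣ M) (N k : ℕ) :
    ∃ s : Fin k → ℕ, (∀ i, (s i).Prime ∧ N < s i ∧ s i ≡ 1 [MOD M]) ∧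
      ∀ i j, i ≠ j → ¬ IsSquare (s i : ZMod (s j)) := by
  induction k with
  | zero => exact ⟨fun i => i.elim0, fun i => i.elim0, fun i => i.elim0⟩
  | succ k ih =>
    obtain ⟨s, hs, hres⟩ := ih
    have hF : ∀ i, Fact (s i).Prime := fun i => ⟨(hs i).1⟩
    have hs4 : ∀ i, s i % 4 = 1 := fun i => (hs i).2.2.of_dvd h4
    have hcop : ((Finset.univ : Finset (Fin k)) : Set (Fin k)).Pairwise
        (Function.onFun Nat.Coprime s) := by
      intro i _ j _ hij
      rw [Function.onFun, Nat.coprime_primes (hs i).1 (hs j).1]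
      intro h
      apply hres i j hij
      rw [h, ZMod.natCast_self]
      exact IsSquare.zero
    have hns : ∀ i, ∃ a : ZMod (s i), ¬ IsSquare a := fun i =>
      FiniteField.exists_nonsquare (by
        rw [ZMod.ringChar_zmod_n]
        intro h
        have := hs4 i
        omega)
    choose a ha using hns
    obtain ⟨x, hx⟩ := Nat.chineseRemainderOfFinset (fun i => (a i).val) s Finset.univ
      (fun i _ => (hs i).1.ne_zero) hcop
    have hxa : ∀ i, (x : ZMod (s i)) = a i := fun i => by
      rw [(ZMod.natCast_eq_natCast_iff _ _ _).mpr (hx i (Finset.mem_univ i)), ZMod.natCast_zmod_val]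
    have hMP : (∏ i, s i).Coprime M :=
      Nat.Coprime.prod_left fun i _ => Nat.Coprime.of_modEq_one (hs i).2.2
    obtain ⟨y, hyx, hy1⟩ := Nat.chineseRemainder hMP x 1
    have hya : ∀ i, (y : ZMod (s i)) = a i := fun i => by
      rw [← hxa, ZMod.natCast_eq_natCast_iff]
      exact hyx.of_dvd (Finset.dvd_prod_of_mem s (Finset.mem_univ i))
    have hycop : y.Coprime ((∏ i, s i) * M) := by
      refine Nat.Coprime.mul_right (Nat.Coprime.prod_right fun i _ => ?_)
        (Nat.Coprime.of_modEq_one hy1)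
      refine Nat.Coprime.symm ((Nat.Prime.coprime_iff_not_dvd (hs i).1).mpr fun h => ha i ?_)
      rw [← hya, (ZMod.natCast_eq_zero_iff _ _).mpr h]
      exact IsSquare.zero
    obtain ⟨ℓ, hℓN, hℓ, hℓy⟩ := Nat.forall_exists_prime_gt_and_modEq N
      (mul_ne_zero (Finset.prod_ne_zero_iff.mpr fun i _ => (hs i).1.ne_zero) hM) hycop
    have hℓ1 : ℓ ≡ 1 [MOD M] := (hℓy.of_dvd (dvd_mul_left _ _)).trans hy1
    have hℓa : ∀ i, ¬ IsSquare (ℓ : ZMod (s i)) := fun i => by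
      have hd : s i ∣ (∏ i, s i) * M :=
        (Finset.dvd_prod_of_mem s (Finset.mem_univ i)).mul_right M
      rw [(ZMod.natCast_eq_natCast_iff _ _ _).mpr (hℓy.of_dvd hd), hya]
      exact ha i
    have := Fact.mk hℓ
    have hℓ4 : ℓ % 4 = 1 := hℓ1.of_dvd h4
    have hℓa' : ∀ i, ¬ IsSquare (s i : ZMod ℓ) := fun i h =>
      hℓa i ((ZMod.exists_sq_eq_prime_iff_of_mod_four_eq_one (p := s i) (q := ℓ) (hs4 i)
        (by rintro rfl; omega)).mpr h)
    refine ⟨Fin.snoc s ℓ, fun i => ?_, fun i j => ?_⟩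
    · refine Fin.lastCases ?_ (fun i => ?_) i
      · simpa using ⟨hℓ, hℓN, hℓ1⟩
      · simpa using hs i
    · refine Fin.lastCases ?_ (fun i => ?_) i <;> refine Fin.lastCases ?_ (fun j => ?_) j
      · simp
      · intro _
        rw [Fin.snoc_last, Fin.snoc_castSucc]
        exact hℓa j
      · intro _
        rw [Fin.snoc_last, Fin.snoc_castSucc]
        exact hℓa' i
      · intro hij
        rw [Fin.snoc_castSucc, Fin.snoc_castSucc]
        exact hres i j fun h => hij (by rw [h])

theorem injective_of_pairwise_not_isSquare {k : ℕ} {s : Fin k → ℕ}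
    (hres : ∀ i j, i ≠ j → ¬ IsSquare (s i : ZMod (s j))) : Function.Injective s := by
  intro i j hij
  by_contra hne
  apply hres i j hne
  rw [hij, ZMod.natCast_self]
  exact IsSquare.zero

/-- Large distinct primes with product `≡ 3 (mod 4)`: all but the last are `≡ 1 (mod 4)`. -/
theorem exists_primes_prod_emod_four (N k : ℕ) :
    ∃ s : Fin (k + 1) → ℕ, (∀ i, (s i).Prime ∧ N < s i) ∧ Function.Injective s ∧
      (∏ i, s i) % 4 = 3 := by
  obtain ⟨s, hs, hres⟩ := exists_primes_pairwise_not_isSquare (M := 4) (by norm_num) dvd_rfl N k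
  obtain ⟨ℓ, hℓN, hℓ, hℓ3⟩ := Nat.forall_exists_prime_gt_and_modEq N (q := 4) (a := 3)
    (by norm_num) (by norm_num)
  refine ⟨Fin.snoc s ℓ, fun i => ?_, ?_, ?_⟩
  · refine Fin.lastCases ?_ (fun i => ?_) i
    · simpa using ⟨hℓ, hℓN⟩
    · simpa using ⟨(hs i).1, (hs i).2.1⟩
  · rw [Fin.snoc_injective_iff]
    refine ⟨injective_of_pairwise_not_isSquare hres, ?_⟩
    rintro ⟨i, rfl⟩
    have := (hs i).2.2.symm.trans hℓ3
    simp [Nat.ModEq] at this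
  · rw [Fin.prod_snoc]
    have h1 : ∏ i, s i ≡ 1 [MOD 4] := by
      simpa using Nat.ModEq.prod (s := Finset.univ) (g := fun _ : Fin k => 1) fun i _ => (hs i).2.2
    simpa [Nat.ModEq] using h1.mul hℓ3

/-! ### Infinitude of the pairs of fields -/

/-- If some prime divides `m` exactly once and not `n`, and `n` is not a square, then `ℚ(√m, √n)` is
bi-quadratic. -/
theorem exists_biquadraticGens_of_prime {m n r : ℤ} (hr : Prime r) (hrm : r ∣ m)
    (hrm2 : ¬ r * r ∣ m) (hrn : ¬ r ∣ n) (hn : ¬ IsSquare n) :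
    Nonempty (BiquadraticGens (biquad m n) m n) := by
  refine nonempty_biquadraticGens
    (mt Rat.isSquare_intCast_iff.mp (not_isSquare_of_prime hr hrm hrm2))
    (mt Rat.isSquare_intCast_iff.mp hn)
    (mt Rat.isSquare_intCast_iff.mp (not_isSquare_of_prime hr (hrm.mul_right n) fun h => hrm2
      (IsCoprime.dvd_of_dvd_mul_right (IsCoprime.mul_left (hr.coprime_iff_not_dvd.mpr hrn)
        (hr.coprime_iff_not_dvd.mpr hrn)) h)))

/-- If integers `m` divisible exactly once by arbitrarily large primes have the property `P`, the
fields `ℚ(√m, √(p - 1))`, `ℚ(√m, √p)` with `P m` form infinitely many pairs, since `ℚ(√m', √p)` does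
not contain `√m` when some prime divides `m` exactly once and does not divide `m' p`. -/
theorem infinite_setOf_biquad {p : ℕ} (hp : p.Prime) {P : ℤ → Prop}
    (hP : ∀ N : ℕ, ∃ (m : ℤ) (r : ℕ), P m ∧ r.Prime ∧ N < r ∧ (r : ℤ) ∣ m ∧ ¬ (r : ℤ) * r ∣ m) :
    {F : IntermediateField ℚ ℂ × IntermediateField ℚ ℂ | ∃ m : ℤ,
      F = (biquad m ((p : ℤ) - 1), biquad m (p : ℤ)) ∧ P m}.Infinite := by
  set f : ℤ → IntermediateField ℚ ℂ × IntermediateField ℚ ℂ :=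
    fun m => (biquad m ((p : ℤ) - 1), biquad m (p : ℤ)) with hf
  set A : Set ℤ := {m | P m ∧ ∃ r : ℕ, r.Prime ∧ p < r ∧ (r : ℤ) ∣ m ∧ ¬ (r : ℤ) * r ∣ m} with hA
  have hpsq : ¬ IsSquare (p : ℤ) := (Nat.prime_iff_prime_int.mp hp).irreducible.not_isSquare
  have hrp : ∀ r : ℕ, p < r → ¬ (r : ℤ) ∣ p := fun r hr h =>
    absurd (Nat.le_of_dvd hp.pos (by exact_mod_cast h)) (by omega)
  suffices h : (f '' A).Infinite by
    refine h.mono ?_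
    rintro _ ⟨m, hm, rfl⟩
    exact ⟨m, rfl, hm.1⟩
  intro hfin
  obtain ⟨A', hA'A, hbij⟩ := Set.exists_subset_bijOn A f
  have hA'fin : A'.Finite := hbij.finite_iff_finite.mpr hfin
  obtain ⟨N, hN⟩ := (hA'fin.image Int.natAbs).bddAbove
  obtain ⟨m, r, hPm, hr, hrN, hrm, hrm2⟩ := hP (N + p)
  have hmA : m ∈ A := ⟨hPm, r, hr, by omega, hrm, hrm2⟩
  obtain ⟨m', hm', hfm⟩ := hbij.surjOn ⟨m, hmA, rfl⟩
  obtain ⟨-, r', hr', hpr', hrm', hrm2'⟩ := hA'A hm'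
  have hpr := Nat.prime_iff_prime_int.mp hr
  obtain ⟨B⟩ := exists_biquadraticGens_of_prime (Nat.prime_iff_prime_int.mp hr') hrm' hrm2'
    (hrp r' hpr') hpsq
  have hK : biquad m' p = biquad m p := congrArg Prod.snd hfm
  obtain ⟨z, hz⟩ := IsAlgClosed.exists_pow_nat_eq (m : ℂ) (n := 2) (by norm_num)
  have hzK : z ∈ biquad m' p := by
    rw [hK]
    exact IntermediateField.subset_adjoin _ _ (Or.inl hz)
  have hzsq : (⟨z, hzK⟩ : biquad m' p) ^ 2 = ((m : ℚ) : biquad m' p) := by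
    apply Subtype.ext
    simpa using hz
  have hrm0 : ¬ (r : ℤ) ∣ m' := by
    intro h
    have h0 : m' ≠ 0 := by rintro rfl; exact hrm2' (dvd_zero _)
    have h1 := Nat.le_of_dvd (Int.natAbs_pos.mpr h0) (Int.natCast_dvd.mp h)
    have h2 : m'.natAbs ≤ N := hN ⟨m', hm', rfl⟩
    omega
  have key : ∀ t : ℤ, ¬ (r : ℤ) ∣ t → ¬ IsSquare (m * t) := fun t ht =>
    not_isSquare_of_prime hpr (hrm.mul_right t) fun h => hrm2
      (IsCoprime.dvd_of_dvd_mul_right (IsCoprime.mul_left (hpr.coprime_iff_not_dvd.mpr ht)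
        (hpr.coprime_iff_not_dvd.mpr ht)) h)
  have hrp' := hrp r (by omega)
  rcases B.rat_square hzsq with h | h | h | h
  · exact not_isSquare_of_prime hpr hrm hrm2 (Rat.isSquare_intCast_iff.mp h)
  · exact key m' hrm0 (Rat.isSquare_intCast_iff.mp (by exact_mod_cast h))
  · exact key p hrp' (Rat.isSquare_intCast_iff.mp (by exact_mod_cast h))
  · refine key (m' * p) (fun h' => (hpr.dvd_mul.mp h').elim hrm0 hrp')
      (Rat.isSquare_intCast_iff.mp ?_)
    rw [← mul_assoc]
    exact_mod_cast h

/-! ### Consecutive bi-quadratic fields with prescribed Pólya group -/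

theorem squarefree_mul_prod_primes {k : ℕ} {s : Fin k → ℕ} (hs : ∀ i, (s i).Prime)
    (hinj : Function.Injective s) {e : ℕ} (he : e.Prime) (hes : ∀ i, s i ≠ e) :
    Squarefree (e * ∏ i, s i) := by
  rw [Nat.squarefree_mul (Nat.Coprime.prod_right fun i _ =>
    (Nat.coprime_primes he (hs i)).mpr (hes i).symm)]
  refine ⟨he.prime.squarefree, Finset.squarefree_prod_of_pairwise_isCoprime ?_
    fun i _ => (hs i).prime.squarefree⟩
  intro i _ j _ hij
  exact Nat.coprime_iff_isRelPrime.mp ((Nat.coprime_primes (hs i) (hs j)).mpr (hinj.ne hij))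

theorem squarefree_two_mul_prime {q : ℕ} (hq : q.Prime) (hq2 : Odd q) :
    Squarefree (2 * q : ℤ) := by
  have : Squarefree (2 * q) := by
    rw [Nat.squarefree_mul (Nat.coprime_two_left.mpr hq2)]
    exact ⟨Nat.prime_two.prime.squarefree, hq.prime.squarefree⟩
  exact_mod_cast Int.squarefree_natCast.mpr this

/-- The Pólya group of `ℚ(√-(e s₁ ⋯ s_k), √n)` for `n = p` or `n = 2 q`. -/
theorem polyaGroup_of_cm {n : ℤ} (hn : Squarefree n) (hnsq : ¬ IsSquare n)
    (hn4 : n % 4 = 2 ∨ n % 4 = 3) (hn5 : 5 ≤ n) {k : ℕ} [NeZero k] {s : Fin k → ℕ}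
    (hs : ∀ i, (s i).Prime) (hinj : Function.Injective s) (hs3 : ∀ i, 3 < s i)
    (hsn : ∀ i, ¬ (s i : ℤ) ∣ 2 * n) {e : ℕ} (he : e.Prime) (hes : ∀ i, s i ≠ e)
    (hmod : (e * ∏ i, s i) % 4 = 3)
    (hen : ¬ (e : ℤ) ∣ 2 * n ∨ ∀ a b : ℤ, a ^ 2 - n * b ^ 2 ≠ e ∧ a ^ 2 - n * b ^ 2 ≠ -e)
    (hrel : (∃ p : ℕ, p.Prime ∧ n = p ∧
        ∃ x y : ℤ, x ^ 2 - n * y ^ 2 = 2 ∨ x ^ 2 - n * y ^ 2 = -2) ∨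
      (∃ q : ℕ, q.Prime ∧ n = 2 * q ∧
        ((∃ x y : ℤ, x ^ 2 - n * y ^ 2 = 2 ∨ x ^ 2 - n * y ^ 2 = -2) ∨ q = e))) :
    Module.finrank ℚ (biquad (-(e * ∏ i, s i : ℕ)) n) = 4 ∧
      Nonempty (polyaGroup (biquad (-(e * ∏ i, s i : ℕ)) n) ≃*
        Multiplicative (Fin k → ZMod 2)) := by
  have hsq : Squarefree (-((e * ∏ i, s i : ℕ) : ℤ)) := by
    rw [← Int.squarefree_natAbs, Int.natAbs_neg, Int.natAbs_natCast]
    exact squarefree_mul_prod_primes hs hinj he hes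
  have hpr := Nat.prime_iff_prime_int.mp (hs 0)
  obtain ⟨B⟩ := exists_biquadraticGens_of_prime (m := -((e * ∏ i, s i : ℕ) : ℤ)) (n := n) hpr
    (by
      rw [dvd_neg, Int.natCast_dvd_natCast]
      exact (Finset.dvd_prod_of_mem s (Finset.mem_univ 0)).mul_left e)
    (fun h => hpr.not_isUnit (hsq _ h)) (fun h => hsn 0 (h.mul_left 2)) hnsq
  refine ⟨B.finrank_eq, B.nonempty_polyaGroup_mulEquiv hsq hn (by omega) hn4 hs hinj he hes
    (by rw [Int.natAbs_neg, Int.natAbs_natCast]) hrel fun S hS α => ?_⟩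
  exact B.not_sq_associated_of_cm hsq hn hn4 hn5 hs hs3 hsn he rfl hen hS α

/-- The Pólya group of `ℚ(√(T₀ ⋯ T_k), √n)`, for `n = p` or `n = 2 q` and primes `T i` which are
pairwise non-residues. The relation `√m` eliminates the class at the last prime, and `k` remain. -/
theorem polyaGroup_of_real {n : ℤ} (hn : Squarefree n) (hnsq : ¬ IsSquare n)
    (hn4 : n % 4 = 2 ∨ n % 4 = 3) (hn0 : 0 < n) (hneg : ∀ x y : ℤ, x ^ 2 - n * y ^ 2 ≠ -1)
    {k : ℕ} (hk : Even k) {T : Fin (k + 1) → ℕ} (hT : ∀ i, (T i).Prime) (hT4 : ∀ i, T i % 4 = 1)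
    (hTn : ∀ i, ¬ (T i : ℤ) ∣ 2 * n)
    (hTsq : ∀ i, ∀ π : ℕ, π.Prime → (π : ℤ) ∣ 2 * n → IsSquare (π : ZMod (T i)))
    (hres : ∀ i j, i ≠ j → ¬ IsSquare (T i : ZMod (T j)))
    (hrel : (∃ p : ℕ, p.Prime ∧ n = p ∧
        ∃ x y : ℤ, x ^ 2 - n * y ^ 2 = 2 ∨ x ^ 2 - n * y ^ 2 = -2) ∨
      (∃ q : ℕ, q.Prime ∧ n = 2 * q ∧
        ∃ x y : ℤ, x ^ 2 - n * y ^ 2 = 2 ∨ x ^ 2 - n * y ^ 2 = -2)) :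
    Module.finrank ℚ (biquad (∏ i, T i : ℕ) n) = 4 ∧
      Nonempty (polyaGroup (biquad (∏ i, T i : ℕ) n) ≃* Multiplicative (Fin k → ZMod 2)) := by
  have hinj := injective_of_pairwise_not_isSquare hres
  have hinj' : Function.Injective fun i : Fin k => T i.castSucc :=
    hinj.comp (Fin.castSucc_injective k)
  have hne : ∀ i : Fin k, T i.castSucc ≠ T (Fin.last k) := fun i h =>
    (Fin.castSucc_lt_last i).ne (hinj h)
  have hprod : ∏ i, T i = T (Fin.last k) * ∏ i : Fin k, T i.castSucc := by
    rw [Fin.prod_univ_castSucc, mul_comm]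
  have hsq : Squarefree ((∏ i, T i : ℕ) : ℤ) := by
    rw [Int.squarefree_natCast, hprod]
    exact squarefree_mul_prod_primes (fun i => hT _) hinj' (hT _) hne
  have hpr := Nat.prime_iff_prime_int.mp (hT 0)
  obtain ⟨B⟩ := exists_biquadraticGens_of_prime (m := ((∏ i, T i : ℕ) : ℤ)) (n := n) hpr
    (by
      rw [Int.natCast_dvd_natCast]
      exact Finset.dvd_prod_of_mem T (Finset.mem_univ 0))
    (fun h => hpr.not_isUnit (hsq _ h)) (fun h => hTn 0 (h.mul_left 2)) hnsq
  have hmod : (∏ i, T i) % 4 = 1 := by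
    have h1 : ∏ i, T i ≡ ∏ _i : Fin (k + 1), 1 [MOD 4] := Nat.ModEq.prod fun i _ => hT4 i
    simpa [Nat.ModEq] using h1
  refine ⟨B.finrank_eq, B.nonempty_polyaGroup_mulEquiv hsq hn (by omega) hn4
    (s := fun i => T i.castSucc) (fun i => hT _) hinj' (hT (Fin.last k)) hne
    (by rw [Int.natAbs_natCast, hprod]) ?_ fun S hS α => ?_⟩
  · rcases hrel with h | ⟨q, hq, hnq, h⟩
    · exact Or.inl h
    · exact Or.inr ⟨q, hq, hnq, Or.inl h⟩
  · have := B.not_sq_associated_of_real hsq hn hn4 hn0 hneg hk.add_one hT hT4 hTn hTsq hres rfl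
      (S := S.map Fin.castSuccEmb) (by simpa using hS) (fun h => by
        have := h ▸ Finset.mem_univ (Fin.last k)
        obtain ⟨i, -, hi⟩ := Finset.mem_map.mp this
        exact (Fin.castSucc_lt_last i).ne hi) α
    rwa [Finset.prod_map] at this

/-- A prime `π` is a square modulo every prime `ℓ ≡ 1 (mod 8 π)`, by quadratic reciprocity. -/
theorem isSquare_natCast_zmod_of_modEq_one {ℓ π : ℕ} (hℓ : ℓ.Prime) (hπ : π.Prime)
    (h8 : ℓ ≡ 1 [MOD 8]) (hℓπ : ℓ ≡ 1 [MOD π]) : IsSquare (π : ZMod ℓ) := by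
  have := Fact.mk hℓ
  have := Fact.mk hπ
  have h8' : ℓ % 8 = 1 := h8
  rcases eq_or_ne π 2 with rfl | h2
  · exact_mod_cast (ZMod.exists_sq_eq_two_iff (by rintro rfl; omega)).mpr (Or.inl h8')
  · refine (ZMod.exists_sq_eq_prime_iff_of_mod_four_eq_one (p := ℓ) (q := π) (by omega) h2).mpr ?_
    rw [(ZMod.natCast_eq_natCast_iff _ _ _).mpr hℓπ]
    exact ⟨1, by simp⟩

section SafePrime

variable {p q : ℕ}

/-- For `r ≥ 1` there is a negative `m`, divisible exactly once by an arbitrarily large prime, with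
both Pólya groups of rank `r`. If `ℤ[√(2 q)]` has an element of norm `± 2`, then `m` is minus a
product of `r + 1` large primes. Otherwise the ideal above `2` is not principal, and neither is the
one above `q`; then `m` is `-q` times a product of `r` large primes, so that `√m` eliminates the
class at `q`, and `√(2 q)` the class at `2`. -/
theorem exists_consecutivePolya_of_cm (hp : p.Prime) (hq : q.Prime) (hq2 : Odd q)
    (hpq : p = 2 * q + 1) {r : ℕ} (hr : 1 ≤ r) (N : ℕ) :
    ∃ (m : ℤ) (ℓ : ℕ), ConsecutivePolya r m p ∧ ℓ.Prime ∧ N < ℓ ∧ (ℓ : ℤ) ∣ m ∧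
      ¬ (ℓ : ℤ) * ℓ ∣ m := by
  have hq3 : 3 ≤ q := by
    have := hq.two_le
    rcases hq2 with ⟨k, rfl⟩
    omega
  have hp4 : p % 4 = 3 := by rcases hq2 with ⟨k, rfl⟩; omega
  have hpp := Nat.prime_iff_prime_int.mp hp
  have hqq := Nat.prime_iff_prime_int.mp hq
  have hn1 : (p : ℤ) - 1 = 2 * q := by rw [hpq]; push_cast; ring
  have h2q := squarefree_two_mul_prime hq hq2
  have h2qsq : ¬ IsSquare (2 * q : ℤ) :=
    not_isSquare_of_prime hqq (dvd_mul_left _ _) fun h => hqq.not_isUnit (h2q _ h)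
  have hlarge : ∀ ℓ : ℕ, ℓ.Prime → N + p < ℓ →
      3 < ℓ ∧ ¬ (ℓ : ℤ) ∣ 2 * p ∧ ¬ (ℓ : ℤ) ∣ 2 * (2 * q) := by
    intro ℓ hℓ hlt
    have h1 : ∀ a : ℕ, a ≤ p → a ≠ 0 → ¬ ℓ ∣ a := fun a ha h0 h =>
      absurd (Nat.le_of_dvd (Nat.pos_of_ne_zero h0) h) (by omega)
    refine ⟨by omega, fun h => ?_, fun h => ?_⟩
    · have h : ℓ ∣ 2 * p := by exact_mod_cast h
      exact (hℓ.dvd_mul.mp h).elim (h1 2 (by omega) two_ne_zero) (h1 p le_rfl hp.ne_zero)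
    · have h : ℓ ∣ 2 * (2 * q) := by exact_mod_cast h
      exact (hℓ.dvd_mul.mp h).elim (h1 2 (by omega) two_ne_zero) (h1 (2 * q) (by omega) (by omega))
  have hpnorm := exists_norm_two_of_prime hp hp4
  have hk : NeZero r := ⟨by omega⟩
  -- it remains to choose the primes
  suffices H : ∃ (s : Fin r → ℕ) (e : ℕ), (∀ i, (s i).Prime ∧ N + p < s i) ∧
      Function.Injective s ∧ e.Prime ∧ (∀ i, s i ≠ e) ∧ (e * ∏ i, s i) % 4 = 3 ∧
      ¬ (e : ℤ) ∣ 2 * p ∧ (¬ (e : ℤ) ∣ 2 * (2 * q) ∨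
        ∀ a b : ℤ, a ^ 2 - (2 * q) * b ^ 2 ≠ e ∧ a ^ 2 - (2 * q) * b ^ 2 ≠ -e) ∧
      ((∃ x y : ℤ, x ^ 2 - (2 * q) * y ^ 2 = 2 ∨ x ^ 2 - (2 * q) * y ^ 2 = -2) ∨ q = e) by
    obtain ⟨s, e, hs, hinj, he, hes, hmod, hep, heq, hrel⟩ := H
    have hl := fun i => hlarge (s i) (hs i).1 (hs i).2
    obtain ⟨f1, P1⟩ := polyaGroup_of_cm h2q h2qsq (Or.inl (by rcases hq2 with ⟨k, rfl⟩; omega))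
      (by omega) (fun i => (hs i).1) hinj (fun i => (hl i).1) (fun i => (hl i).2.2) he hes hmod heq
      (Or.inr ⟨q, hq, rfl, hrel⟩)
    obtain ⟨f2, P2⟩ := polyaGroup_of_cm hpp.squarefree hpp.irreducible.not_isSquare
      (Or.inr (by omega)) (by omega) (fun i => (hs i).1) hinj (fun i => (hl i).1)
      (fun i => (hl i).2.1) he hes hmod (Or.inl hep) (Or.inl ⟨p, hp, rfl, hpnorm⟩)
    refine ⟨-(e * ∏ i, s i : ℕ), s 0, ?_, (hs 0).1, by have := (hs 0).2; omega, ?_, ?_⟩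
    · unfold ConsecutivePolya
      rw [← hn1] at f1 P1
      exact ⟨f1, f2, P1, P2⟩
    · rw [dvd_neg, Int.natCast_dvd_natCast]
      exact (Finset.dvd_prod_of_mem s (Finset.mem_univ 0)).mul_left e
    · rw [dvd_neg]
      intro h
      have h' : s 0 * s 0 ∣ e * ∏ i, s i := by exact_mod_cast h
      exact (hs 0).1.prime.not_isUnit
        (squarefree_mul_prod_primes (fun i => (hs i).1) hinj he hes _ h')
  by_cases G : ∃ x y : ℤ, x ^ 2 - (2 * q) * y ^ 2 = 2 ∨ x ^ 2 - (2 * q) * y ^ 2 = -2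
  · obtain ⟨s, hs, hinj, hmod⟩ := exists_primes_prod_emod_four (N + p) r
    have hl := hlarge _ (hs (Fin.last r)).1 (hs (Fin.last r)).2
    refine ⟨fun i => s i.castSucc, s (Fin.last r), fun i => hs _,
      hinj.comp (Fin.castSucc_injective r), (hs _).1,
      fun i h => (Fin.castSucc_lt_last i).ne (hinj h), ?_, hl.2.1, Or.inl hl.2.2, Or.inl G⟩
    rwa [Fin.prod_univ_castSucc, mul_comm] at hmod
  · -- `e = q`, which is not a norm up to sign: an element of norm `± q` times `√(2 q)` would be
    -- `q` times an element of norm `∓ 2`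
    obtain ⟨k, rfl⟩ : ∃ k, r = k + 1 := ⟨r - 1, by omega⟩
    obtain ⟨s, hs, hinj, hmod⟩ := exists_primes_prod_emod_four (N + p) k
    have hq4 : q % 4 = 1 := by
      have : q % 4 ≠ 3 := fun h => G (exists_norm_two_of_two_mul_prime hq h)
      rcases hq2 with ⟨k, rfl⟩
      omega
    refine ⟨s, q, hs, hinj, hq, fun i h => by have := (hs i).2; omega, ?_, fun h => ?_,
      Or.inr fun a b => ?_, Or.inr rfl⟩
    · rw [Nat.mul_mod, hq4, hmod]
    · have h : q ∣ 2 * p := by exact_mod_cast h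
      rcases hq.dvd_mul.mp h with h | h
      · exact absurd (Nat.le_of_dvd two_pos h) (by omega)
      · have := (Nat.prime_dvd_prime_iff_eq hq hp).mp h
        omega
    · have hkey : ∀ ε : ℤ, ε = 1 ∨ ε = -1 → a ^ 2 - (2 * q) * b ^ 2 ≠ ε * q := by
        intro ε hε h
        have hqa : (q : ℤ) ∣ a := hqq.dvd_of_dvd_pow (n := 2)
          ⟨ε + 2 * b ^ 2, by linear_combination h⟩
        obtain ⟨c, rfl⟩ := hqa
        have h2 : q * c ^ 2 - 2 * b ^ 2 = ε := by
          apply mul_left_cancel₀ hqq.ne_zero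
          linear_combination h
        refine G ⟨2 * b, c, ?_⟩
        have h3 : (2 * b) ^ 2 - 2 * q * c ^ 2 = -2 * ε := by linear_combination -2 * h2
        rcases hε with rfl | rfl
        · exact Or.inr (by rw [h3]; norm_num)
        · exact Or.inl (by rw [h3]; norm_num)
      exact ⟨by simpa using hkey 1 (Or.inl rfl), by simpa using hkey (-1) (Or.inr rfl)⟩

/-- For `r` even and `q ≡ 3 (mod 4)`, a product `m` of `r + 1` large primes `≡ 1 (mod 8 p q)` which
are pairwise non-residues makes both Pólya groups of rank `r`. -/
theorem exists_consecutivePolya_of_real (hp : p.Prime) (hq : q.Prime) (hq4 : q % 4 = 3)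
    (hpq : p = 2 * q + 1) {r : ℕ} (hr : Even r) (N : ℕ) :
    ∃ (m : ℤ) (ℓ : ℕ), (ConsecutivePolya r m p ∧ IsNonresidueProduct (8 * p * q) (r + 1) m) ∧
      ℓ.Prime ∧ N < ℓ ∧ (ℓ : ℤ) ∣ m ∧ ¬ (ℓ : ℤ) * ℓ ∣ m := by
  have hp4 : p % 4 = 3 := by omega
  have hpp := Nat.prime_iff_prime_int.mp hp
  have hqq := Nat.prime_iff_prime_int.mp hq
  have hn1 : (p : ℤ) - 1 = 2 * q := by rw [hpq]; push_cast; ring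
  have h2q := squarefree_two_mul_prime hq (Nat.odd_iff.mpr (by omega))
  have h2qsq : ¬ IsSquare (2 * q : ℤ) :=
    not_isSquare_of_prime hqq (dvd_mul_left _ _) fun h => hqq.not_isUnit (h2q _ h)
  have hM : 8 * p * q ≠ 0 := mul_ne_zero (mul_ne_zero (by norm_num) hp.ne_zero) hq.ne_zero
  obtain ⟨T, hT, hres⟩ := exists_primes_pairwise_not_isSquare hM ⟨2 * p * q, by ring⟩ N (r + 1)
  have hTp := fun i => (hT i).1
  have hT8 : ∀ i, T i ≡ 1 [MOD 8] := fun i => (hT i).2.2.of_dvd ⟨p * q, by ring⟩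
  have hT1 : ∀ i, ∀ π : ℕ, π.Prime → π ∣ 2 * p ∨ π ∣ 2 * (2 * q) →
      T i ≡ 1 [MOD π] := by
    intro i π hπ h
    refine (hT i).2.2.of_dvd ?_
    rcases h with h | h
    · exact h.trans ⟨4 * q, by ring⟩
    · exact h.trans ⟨2 * p, by ring⟩
  have hT4 : ∀ i, T i % 4 = 1 := fun i => (hT8 i).of_dvd (by norm_num)
  have hTn : ∀ i, ¬ (T i ∣ 2 * p ∨ T i ∣ 2 * (2 * q)) := fun i h => by
    have h1 := hT1 i (T i) (hTp i) h
    have h2 : T i ∣ 1 := (h1.dvd_iff dvd_rfl).mp dvd_rfl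
    exact (hTp i).one_lt.ne' (Nat.dvd_one.mp h2)
  have hTsq : ∀ i, ∀ π : ℕ, π.Prime → π ∣ 2 * p ∨ π ∣ 2 * (2 * q) → IsSquare (π : ZMod (T i)) :=
    fun i π hπ h => isSquare_natCast_zmod_of_modEq_one (hTp i) hπ (hT8 i) (hT1 i π hπ h)
  obtain ⟨f1, P1⟩ := polyaGroup_of_real h2q h2qsq (Or.inl (by omega)) (by omega)
    -- no element of norm `-1`, by reduction modulo `8`
    (fun x y h => by
      have hy : x ^ 2 - 2 * q * y ^ 2 = x ^ 2 - 2 * (q * y ^ 2) := by ring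
      obtain ⟨k, hk⟩ : ∃ k : ℤ, (q : ℤ) = 4 * k + 3 := ⟨q / 4, by omega⟩
      have hy' : (q : ℤ) * y ^ 2 = 4 * (k * y ^ 2) + 3 * y ^ 2 := by rw [hk]; ring
      rcases Int.sq_emod_eight x with h1 | h1 | h1 <;>
        rcases Int.sq_emod_eight y with h2 | h2 | h2 <;> omega) hr hTp hT4
    (fun i h => hTn i (Or.inr (by exact_mod_cast h)))
    (fun i π hπ h => hTsq i π hπ (Or.inr (by exact_mod_cast h))) hres
    (Or.inr ⟨q, hq, rfl, exists_norm_two_of_two_mul_prime hq hq4⟩)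
  obtain ⟨f2, P2⟩ := polyaGroup_of_real hpp.squarefree hpp.irreducible.not_isSquare
    (Or.inr (by omega)) (by omega)
    -- no element of norm `-1`, by reduction modulo `4`
    (fun x y h => by
      obtain ⟨k, hk⟩ : ∃ k : ℤ, (p : ℤ) = 4 * k + 3 := ⟨p / 4, by omega⟩
      have hy' : (p : ℤ) * y ^ 2 = 4 * (k * y ^ 2) + 3 * y ^ 2 := by rw [hk]; ring
      rcases Int.sq_emod_four x with h1 | h1 <;>
        rcases Int.sq_emod_four y with h2 | h2 <;> omega) hr hTp hT4
    (fun i h => hTn i (Or.inl (by exact_mod_cast h)))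
    (fun i π hπ h => hTsq i π hπ (Or.inl (by exact_mod_cast h))) hres
    (Or.inl ⟨p, hp, rfl, exists_norm_two_of_prime hp hp4⟩)
  refine ⟨(∏ i, T i : ℕ), T 0, ⟨?_, T, fun i => ⟨hTp i, (hT i).2.2⟩, hres, by push_cast; rfl⟩,
    hTp 0, (hT 0).2.1, ?_, fun h => ?_⟩
  · unfold ConsecutivePolya
    rw [← hn1] at f1 P1
    exact ⟨f1, f2, P1, P2⟩
  · rw [Int.natCast_dvd_natCast]
    exact Finset.dvd_prod_of_mem T (Finset.mem_univ 0)
  · have hinj := injective_of_pairwise_not_isSquare hres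
    have hsq := squarefree_mul_prod_primes (s := fun i : Fin r => T i.succ) (fun i => hTp _)
      (hinj.comp (Fin.succ_injective r)) (hTp 0) fun i h => Fin.succ_ne_zero i (hinj h)
    rw [← Fin.prod_univ_succ] at hsq
    exact (hTp 0).prime.not_isUnit (hsq _ (by exact_mod_cast h))

end SafePrime

theorem theorem1p2 (p q : ℕ) (hp : p.Prime) (hq : q.Prime) (hp2 : Odd p) (hq2 : Odd q)
    (hpq : p = 2 * q + 1) (r : ℕ) (hr1 : 1 ≤ r) (hr2 : Even r) :
    {F : IntermediateField ℚ ℂ × IntermediateField ℚ ℂ | ∃ m : ℤ,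
      F = (biquad m ((p : ℤ) - 1), biquad m (p : ℤ)) ∧
      ConsecutivePolya r m p}.Infinite ∧
    (q ≡ 3 [MOD 4] →
      {F : IntermediateField ℚ ℂ × IntermediateField ℚ ℂ | ∃ m : ℤ,
        F = (biquad m ((p : ℤ) - 1), biquad m (p : ℤ)) ∧
        ConsecutivePolya r m p ∧
        IsNonresidueProduct (8 * p * q) (r + 1) m}.Infinite) :=
  ⟨infinite_setOf_biquad hp fun N => exists_consecutivePolya_of_cm hp hq hq2 hpq hr1 N,
    fun hq4 => infinite_setOf_biquad hp fun N =>
      exists_consecutivePolya_of_real hp hq hq4 hpq hr2 N⟩
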